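/- Let $q$ be an odd prime power, let $t,m,k$ be integers with $t\ge 1$, $2t\le m$ and $1\le k\le m$, and let $\delta\in\mathbb F_q^*$. For a matrix $A$ put $f_0^\delta(A)=0$ and $f_j^\delta(A)=A_{11}+\cdots+A_{j-1,j-1}+\delta A_{jj}$ for $j\ge 1$. Let $S(r,n)$ be the set of symmetric $n\times n$ matrices over $\mathbb F_q$ of rank $r$. A matrix $A\in S(2t,n)$ is called *hyperbolic* if its quadratic form $Q_A(x)=xAx^T$ can be written as $c(X_1X_2+\cdots+X_{2t-1}X_{2t})$, and *elliptic* if $Q_A$ can be written as $c(f(X_1,X_2)+X_3X_4+\cdots+X_{2t-1}X_{2t})$, where $c\in\mathbb F_q^*$, the $X_i$ are linearly independent linear forms over $\mathbb F_q$, and $f$ is an irreducible homogeneous polynomial of degree $2$ over $\mathbb F_q$. Let $$H=\{A\in S(2t,m): A\text{ hyperbolic},\ f_k^\delta(A)=0\},\qquad E=\{A\in S(2t,m): A\text{ elliptic},\ f_k^\delta(A)=0\},$$ and $h_k^\delta(2t,m)=|H|$, $e_k^\delta(2t,m)=|E|$. Then $$h_k^\delta(2t,m)-e_k^\delta(2t,m)\le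 q\,\frac{\prod_{i=0}^{2t-2}(q^{m-1}-q^i)}{\prod_{i=0}^{t-2}(q^{2t-2}-q^{2i})}+q^{2t}\,\frac{\prod_{i=0}^{2t-1}(q^{m-1}-q^i)}{\prod_{i=0}^{t-1}(q^{2t}-q^{2i})}$$ (an empty product is $1$). Moreover, for every $B\in S(2t-1,m-1)$ with $f_{k-1}^\delta(B)\ne 0$, the number of $A\in H$ from which deleting the first row and the first column gives $B$, minus the number of $A\in E$ with the same property, equals $-q^{t-1}$. -/

import Mathlib

/-- `S(r, m)`: the symmetric `m × m` matrices over `F` of rank `r`. -/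
def symRank (F : Type*) [Field F] (r m : ℕ) : Set (Matrix (Fin m) (Fin m) F) :=
  {A | A.IsSymm ∧ A.rank = r}

/-- The value at `A` of the quadratic form `Q_A(x) = x A xᵀ`. -/
def quadVal {F : Type*} [Field F] {m : ℕ} (A : Matrix (Fin m) (Fin m) F) (x : Fin m → F) : F :=
  x ⬝ᵥ (A.mulVec x)

/-- `A` is of hyperbolic type, with `2t` variables: `Q_A = c (X₁X₂ + ⋯ + X₂ₜ₋₁X₂ₜ)` for a
non-zero constant `c` and linearly independent linear forms `X₁, …, X₂ₜ`
(here `X₂ᵢ₊₁ = X (i, 0)` and `X₂ᵢ₊₂ = X (i, 1)` for `0 ≤ i < t`). -/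
def IsHyperbolic {F : Type*} [Field F] {m : ℕ} (t : ℕ) (A : Matrix (Fin m) (Fin m) F) : Prop :=
  ∃ (c : F) (X : Fin t × Fin 2 → Module.Dual F (Fin m → F)),
    c ≠ 0 ∧ LinearIndependent F X ∧
      ∀ x, quadVal A x = c * ∑ i : Fin t, X (i, 0) x * X (i, 1) x

/-- `A` is of elliptic type, with `2t` variables: `Q_A = c (f(X₁, X₂) + X₃X₄ + ⋯ + X₂ₜ₋₁X₂ₜ)`
for a non-zero constant `c`, an irreducible homogeneous polynomial `f` of degree `2` in two
variables, and linearly independent linear forms `X₁, …, X₂ₜ` (so `t = s + 1 ≥ 1`). -/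
def IsElliptic {F : Type*} [Field F] {m : ℕ} (t : ℕ) (A : Matrix (Fin m) (Fin m) F) : Prop :=
  ∃ (s : ℕ) (c : F) (f : MvPolynomial (Fin 2) F)
    (X : Fin (s + 1) × Fin 2 → Module.Dual F (Fin m → F)),
    t = s + 1 ∧ c ≠ 0 ∧ f.IsHomogeneous 2 ∧ Irreducible f ∧ LinearIndependent F X ∧
      ∀ x, quadVal A x =
        c * (MvPolynomial.eval (fun j => X (0, j) x) f
          + ∑ i : Fin s, X (i.succ, 0) x * X (i.succ, 1) x)

/-- `f_k^δ(A) = A₁₁ + ⋯ + A_{k-1,k-1} + δ A_{kk}` (rows and columns numbered from `1`);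
it is `0` for `k = 0`. The row with index `i : Fin m` is row number `i + 1`. -/
def diagForm {F : Type*} [Field F] {m : ℕ} (k : ℕ) (δ : F) (A : Matrix (Fin m) (Fin m) F) : F :=
  ∑ i : Fin m, if (i : ℕ) + 1 < k then A i i else if (i : ℕ) + 1 = k then δ * A i i else 0

/-- `H_k^δ(2t, m)`. -/
def hypSet {F : Type*} [Field F] (k : ℕ) (δ : F) (t m : ℕ) : Set (Matrix (Fin m) (Fin m) F) :=
  {A | A ∈ symRank F (2 * t) m ∧ IsHyperbolic t A ∧ diagForm k δ A = 0}

/-- `E_k^δ(2t, m)`. -/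
def ellSet {F : Type*} [Field F] (k : ℕ) (δ : F) (t m : ℕ) : Set (Matrix (Fin m) (Fin m) F) :=
  {A | A ∈ symRank F (2 * t) m ∧ IsElliptic t A ∧ diagForm k δ A = 0}

/-- Deleting the first row and the first column of a square matrix. -/
def deleteFirst {F : Type*} {m : ℕ} (A : Matrix (Fin m) (Fin m) F) :
    Matrix (Fin (m - 1)) (Fin (m - 1)) F :=
  A.submatrix (fun i => ⟨(i : ℕ) + 1, by omega⟩) (fun i => ⟨(i : ℕ) + 1, by omega⟩)

/-- `h_k^δ(2t, m)`, the number of elements of `H_k^δ(2t, m)`. -/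
noncomputable def hypCount {F : Type*} [Field F] (k : ℕ) (δ : F) (t m : ℕ) : ℕ :=
  (hypSet k δ t m).ncard

/-- `e_k^δ(2t, m)`, the number of elements of `E_k^δ(2t, m)`. -/
noncomputable def ellCount {F : Type*} [Field F] (k : ℕ) (δ : F) (t m : ℕ) : ℕ :=
  (ellSet k δ t m).ncard

/-- The number of elements in the fibre over `B` of the map on `H_k^δ(2t, m)` that deletes the
first row and column. -/
noncomputable def hypFibre {F : Type*} [Field F] (k : ℕ) (δ : F) (t m : ℕ)
    (B : Matrix (Fin (m - 1)) (Fin (m - 1)) F) : ℕ :=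
  {A | A ∈ hypSet k δ t m ∧ deleteFirst A = B}.ncard

/-- The number of elements in the fibre over `B` of the map on `E_k^δ(2t, m)` that deletes the
first row and column. -/
noncomputable def ellFibre {F : Type*} [Field F] (k : ℕ) (δ : F) (t m : ℕ)
    (B : Matrix (Fin (m - 1)) (Fin (m - 1)) F) : ℕ :=
  {A | A ∈ ellSet k δ t m ∧ deleteFirst A = B}.ncard

/-! For a nontrivial additive character ψ, the exponential sum of the quadratic form of a symmetric
m × m matrix of rank 2t is ε q^(m-t), with ε = 1 in the hyperbolic and ε = -1 in the elliptic case
(`typeSign_spec`). Hence h - e is a sum of signs ε, and signs can be computed with Gauss sums.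

Write A as a block B bordered by a vector v with corner a. The equation f_k^δ(A) = 0 forces a to be
a fixed non-zero multiple of f_{k-1}^δ(B), so h - e is the sum over B of the signed number of
borders v at that corner (`sum_diagForm_eq_zero`). If v = Bw, a shear turns the bordered form into
Q_B plus (a - Q_B(w)) times a square; if v is outside the column space of B, a hyperbolic plane
splits off. Summing over v shows that the corner enters only through the Ramanujan sum c(a) of all
ψ(sa) with s ≠ 0, which is q - 1 at a = 0 and -1 elsewhere, with a nonnegative coefficient
(`card_mul_borderSum`).

For B of rank 2t - 1 the signed count is q^(t-1) c(a), which is -q^(t-1) when f_{k-1}^δ(B) ≠ 0; this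
is the fibre statement. For the inequality, every corner may be replaced by 0, where c is largest.
The resulting sum over B is the signed count of all symmetric matrices, since non-zero corners
contribute nothing in total: complete the square and use that the quadratic character sums to zero.
Finally, summing over all corners kills c(a) and gives a recurrence in the matrix size
(`typeSum_succ_succ`); it has a product solution, and one application at size m gives the two terms
of the bound. -/

set_option linter.unusedSectionVars false

/-! ### Bordered matrices -/

/-- The matrix with upper left corner `a`, first row and first column bordered by `v`, and
remaining block `B`. -/
def bord {F : Type*} {n : ℕ} (a : F) (v : Fin n → F) (B : Matrix (Fin n) (Fin n) F) :
    Matrix (Fin (n + 1)) (Fin (n + 1)) F :=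
  Matrix.of (Fin.cons (Fin.cons a v) fun i => Fin.cons (v i) (B i))

section Bord

variable {F : Type*} {n : ℕ}

@[simp] theorem bord_zero_zero (a : F) (v : Fin n → F) (B : Matrix (Fin n) (Fin n) F) :
    bord a v B 0 0 = a := rfl

@[simp] theorem bord_zero_succ (a : F) (v : Fin n → F) (B : Matrix (Fin n) (Fin n) F)
    (j : Fin n) : bord a v B 0 j.succ = v j := rfl

@[simp] theorem bord_succ_zero (a : F) (v : Fin n → F) (B : Matrix (Fin n) (Fin n) F)
    (i : Fin n) : bord a v B i.succ 0 = v i := rfl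

@[simp] theorem bord_succ_succ (a : F) (v : Fin n → F) (B : Matrix (Fin n) (Fin n) F)
    (i j : Fin n) : bord a v B i.succ j.succ = B i j := rfl

theorem bord_isSymm {a : F} {v : Fin n → F} {B : Matrix (Fin n) (Fin n) F} (hB : B.IsSymm) :
    (bord a v B).IsSymm := by
  ext i j
  refine Fin.cases ?_ (fun i => ?_) i <;> refine Fin.cases ?_ (fun j => ?_) j <;>
    simp [Matrix.transpose_apply, hB.apply]

/-- A symmetric matrix is its corner bordered by its first row. -/
theorem eq_bord {A : Matrix (Fin (n + 1)) (Fin (n + 1)) F} (hA : A.IsSymm) :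
    A = bord (A 0 0) (fun j => A 0 j.succ) (A.submatrix Fin.succ Fin.succ) := by
  ext i j
  refine Fin.cases ?_ (fun i => ?_) i <;> refine Fin.cases ?_ (fun j => ?_) j <;>
    simp [hA.apply]

theorem submatrix_bord (a : F) (v : Fin n → F) (B : Matrix (Fin n) (Fin n) F) :
    (bord a v B).submatrix Fin.succ Fin.succ = B := rfl

variable [Field F]

theorem bord_mulVec_cons (a : F) (v : Fin n → F) (B : Matrix (Fin n) (Fin n) F)
    (x : F) (y : Fin n → F) :
    (bord a v B).mulVec (Fin.cons x y) = Fin.cons (a * x + v ⬝ᵥ y) (x • v + B.mulVec y) := by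
  ext i
  refine Fin.cases ?_ (fun i => ?_) i
  · simp [Matrix.mulVec, dotProduct, Fin.sum_univ_succ]
  · simp [Matrix.mulVec, dotProduct, Fin.sum_univ_succ, mul_comm]

theorem quadVal_bord (a : F) (v : Fin n → F) (B : Matrix (Fin n) (Fin n) F)
    (x : F) (y : Fin n → F) :
    quadVal (bord a v B) (Fin.cons x y) = a * x ^ 2 + 2 * x * (v ⬝ᵥ y) + quadVal B y := by
  have h : ∀ (c : F) (z : Fin n → F),
      (Fin.cons x y : Fin (n + 1) → F) ⬝ᵥ Fin.cons c z = x * c + y ⬝ᵥ z := fun c z => by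
    simp [dotProduct, Fin.sum_univ_succ]
  rw [quadVal, bord_mulVec_cons, h, dotProduct_add, dotProduct_smul, dotProduct_comm y v,
    quadVal, smul_eq_mul]
  ring

end Bord

/-! ### Quadratic forms of symmetric matrices -/

section QuadVal

variable {F : Type*} [Field F] {m : ℕ}

theorem dotProduct_mulVec_comm {A : Matrix (Fin m) (Fin m) F} (hA : A.IsSymm)
    (x y : Fin m → F) : x ⬝ᵥ A.mulVec y = y ⬝ᵥ A.mulVec x := by
  rw [Matrix.dotProduct_mulVec, ← Matrix.mulVec_transpose, hA.eq, dotProduct_comm]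

theorem quadVal_add {A : Matrix (Fin m) (Fin m) F} (hA : A.IsSymm) (x y : Fin m → F) :
    quadVal A (x + y) = quadVal A x + 2 * (x ⬝ᵥ A.mulVec y) + quadVal A y := by
  simp only [quadVal, Matrix.mulVec_add, dotProduct_add, add_dotProduct]
  rw [dotProduct_mulVec_comm hA y x]
  ring

theorem quadVal_smul (A : Matrix (Fin m) (Fin m) F) (c : F) (x : Fin m → F) :
    quadVal A (c • x) = c ^ 2 * quadVal A x := by
  simp only [quadVal, Matrix.mulVec_smul, dotProduct_smul, smul_dotProduct, smul_eq_mul]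
  ring

theorem quadVal_add_of_mulVec_eq_zero {A : Matrix (Fin m) (Fin m) F} (hA : A.IsSymm)
    (x : Fin m → F) {z : Fin m → F} (hz : A.mulVec z = 0) :
    quadVal A (x + z) = quadVal A x := by
  rw [quadVal_add hA, hz, quadVal.eq_1 A z, hz]
  simp

/-- The radical of the quadratic form is the kernel of the matrix. -/
theorem mulVec_eq_zero_of_forall_quadVal_add (h2 : (2 : F) ≠ 0)
    {A : Matrix (Fin m) (Fin m) F} (hA : A.IsSymm) {z : Fin m → F}
    (h : ∀ x, quadVal A (x + z) = quadVal A x) : A.mulVec z = 0 := by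
  have h0 : quadVal A z = 0 := by simpa [quadVal] using h 0
  refine dotProduct_eq_zero _ fun x => ?_
  have := h x
  rw [quadVal_add hA, h0, add_zero, add_eq_left, mul_eq_zero] at this
  rw [dotProduct_comm]
  exact this.resolve_left h2

/-- The quadratic form of a matrix bordered by a vector of its column space. -/
theorem quadVal_bord_mulVec {n : ℕ} {B : Matrix (Fin n) (Fin n) F} (hB : B.IsSymm) (a : F)
    (w : Fin n → F) (x : F) (y : Fin n → F) :
    quadVal (bord a (B.mulVec w) B) (Fin.cons x y) =
      (a - quadVal B w) * x ^ 2 + quadVal B (y + x • w) := by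
  rw [quadVal_bord, quadVal_add hB, quadVal_smul, Matrix.mulVec_smul, dotProduct_smul,
    dotProduct_comm (B.mulVec w), smul_eq_mul]
  ring

/-- The quadratic form of a symmetric matrix with non-zero corner, after completing the
square. -/
theorem quadVal_bord_add_vecMulVec {n : ℕ} {a : F} (ha : a ≠ 0) (v : Fin n → F)
    (B : Matrix (Fin n) (Fin n) F) (x : F) (y : Fin n → F) :
    quadVal (bord a v (B + a⁻¹ • Matrix.vecMulVec v v)) (Fin.cons x y) =
      quadVal (bord a 0 B) (Fin.cons (x + a⁻¹ * (v ⬝ᵥ y)) y) := by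
  have : quadVal (B + a⁻¹ • Matrix.vecMulVec v v) y =
      quadVal B y + a⁻¹ * (v ⬝ᵥ y) ^ 2 := by
    simp only [quadVal, Matrix.add_mulVec, Matrix.smul_mulVec, Matrix.vecMulVec_mulVec,
      dotProduct_add, dotProduct_smul, smul_eq_mul, MulOpposite.smul_eq_mul_unop,
      MulOpposite.unop_op]
    rw [dotProduct_comm y v]
    ring
  rw [quadVal_bord, quadVal_bord, this, zero_dotProduct]
  field_simp
  ring

/-- A vector outside the column space of a symmetric matrix pairs to `1` with some vector of
its kernel. -/
theorem exists_mulVec_eq_zero_dotProduct_eq_one {B : Matrix (Fin m) (Fin m) F}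
    (hB : B.IsSymm) {v : Fin m → F} (hv : v ∉ Set.range B.mulVec) :
    ∃ z, B.mulVec z = 0 ∧ v ⬝ᵥ z = 1 := by
  have hv' : v ∉ LinearMap.range B.mulVecLin := by simpa using hv
  obtain ⟨f, hfv, hf⟩ := Submodule.exists_le_ker_of_notMem hv'
  set z : Fin m → F := fun i => f (Pi.single i 1) with hz
  have hfz : ∀ y, f y = y ⬝ᵥ z := fun y => by
    conv_lhs => rw [LinearMap.pi_apply_eq_sum_univ f y]
    simp only [dotProduct, hz, smul_eq_mul]
    refine Finset.sum_congr rfl fun i _ => ?_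
    congr 2
    ext j
    simp [Pi.single_apply, eq_comm]
  refine ⟨(f v)⁻¹ • z, ?_, ?_⟩
  · rw [Matrix.mulVec_smul]
    have : B.mulVec z = 0 := dotProduct_eq_zero _ fun y => by
      have := hf (LinearMap.mem_range_self B.mulVecLin y)
      rw [LinearMap.mem_ker, Matrix.mulVecLin_apply, hfz] at this
      rw [dotProduct_comm, ← this, dotProduct_mulVec_comm hB, dotProduct_comm]
    rw [this, smul_zero]
  · rw [dotProduct_smul, ← hfz, smul_eq_mul, inv_mul_cancel₀ hfv]

end QuadVal

/-! ### Ranks of bordered matrices, by counting kernels -/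

section Rank

variable {F : Type*} [Field F] [Fintype F] {m n : ℕ}

theorem card_ker_mul_pow_rank (A : Matrix (Fin m) (Fin m) F) :
    Nat.card {x // A.mulVec x = 0} * Fintype.card F ^ A.rank = Fintype.card F ^ m := by
  have h1 : Nat.card {x // A.mulVec x = 0} = Nat.card (LinearMap.ker A.mulVecLin) :=
    Nat.card_congr (Equiv.subtypeEquivRight fun x => by simp)
  rw [h1, Module.natCard_eq_pow_finrank (K := F), Nat.card_eq_fintype_card, ← pow_add,
    Matrix.rank, add_comm, LinearMap.finrank_range_add_finrank_ker, Module.finrank_fin_fun]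

/-- Over a finite field rank-nullity reads the rank off the number of kernel vectors, so ranks can
be compared through bijections of kernels; `c` and `d` allow for extra free coordinates. -/
theorem rank_eq_of_card_ker (A : Matrix (Fin m) (Fin m) F) (B : Matrix (Fin n) (Fin n) F)
    {c d : ℕ} (h : Nat.card {x // A.mulVec x = 0} * Fintype.card F ^ c =
      Nat.card {x // B.mulVec x = 0} * Fintype.card F ^ d) :
    A.rank + n + d = B.rank + m + c := by
  have hq : 1 < Fintype.card F := Fintype.one_lt_card
  have hA := card_ker_mul_pow_rank A
  have hB := card_ker_mul_pow_rank B
  have hpos : 0 < Nat.card {x // A.mulVec x = 0} * Fintype.card F ^ c := by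
    have : Nonempty {x // A.mulVec x = 0} := ⟨0, by simp⟩
    have := Nat.card_pos (α := {x // A.mulVec x = 0})
    positivity
  -- Multiplying by the square of the common value in `h` reduces the goal to the two kernel counts
  -- without any division.
  refine Nat.pow_right_injective hq (Nat.eq_of_mul_eq_mul_left (Nat.mul_pos hpos hpos) ?_)
  beta_reduce
  simp only [pow_add]
  rw [← hA, ← hB]
  generalize Nat.card {x // A.mulVec x = 0} = α at *
  generalize Nat.card {x // B.mulVec x = 0} = β at *
  generalize Fintype.card F = q at *
  calc _ = (α * q ^ c) * (α * q ^ c) * q ^ d * q ^ A.rank * (β * q ^ B.rank) := by ring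
    _ = (β * q ^ d) * (β * q ^ d) * (q ^ A.rank * q ^ B.rank) * (α * q ^ c) := by
      nth_rw 1 [h]; ring
    _ = _ := by rw [← h]; ring

/-- Symmetric matrices with equivalent quadratic forms have the same rank. -/
theorem rank_eq_of_quadVal_comp (h2 : (2 : F) ≠ 0) {A A' : Matrix (Fin m) (Fin m) F}
    (hA : A.IsSymm) (hA' : A'.IsSymm) (L : (Fin m → F) ≃+ (Fin m → F))
    (h : ∀ x, quadVal A' x = quadVal A (L x)) : A'.rank = A.rank := by
  have key : Nat.card {x // A'.mulVec x = 0} = Nat.card {x // A.mulVec x = 0} := by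
    refine Nat.card_congr (L.toEquiv.subtypeEquiv fun z => ⟨fun hz => ?_, fun hz => ?_⟩)
    · refine mulVec_eq_zero_of_forall_quadVal_add h2 hA fun x => ?_
      obtain ⟨x, rfl⟩ := L.surjective x
      have := quadVal_add_of_mulVec_eq_zero hA' x hz
      rwa [h, h, map_add] at this
    · refine mulVec_eq_zero_of_forall_quadVal_add h2 hA' fun x => ?_
      rw [h, h, map_add]
      exact quadVal_add_of_mulVec_eq_zero hA _ hz
  have := rank_eq_of_card_ker A' A (c := 0) (d := 0) (by rw [key])
  omega

theorem mulVec_bord_cons_eq_zero {a : F} {v : Fin n → F} {B : Matrix (Fin n) (Fin n) F}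
    {x : F} {y : Fin n → F} : (bord a v B).mulVec (Fin.cons x y) = 0 ↔
      a * x + v ⬝ᵥ y = 0 ∧ x • v + B.mulVec y = 0 := by
  rw [bord_mulVec_cons]
  constructor
  · intro h
    exact ⟨congrFun h 0, funext fun i => congrFun h i.succ⟩
  · rintro ⟨h1, h2⟩
    rw [h1, h2]
    ext i
    refine Fin.cases ?_ (fun i => ?_) i <;> simp

theorem rank_bord_zero (a : F) (B : Matrix (Fin n) (Fin n) F) [Decidable (a = 0)] :
    (bord a 0 B).rank = B.rank + if a = 0 then 0 else 1 := by
  have hker : ∀ x : Fin (n + 1) → F, (bord a 0 B).mulVec x = 0 ↔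
      a * x 0 = 0 ∧ B.mulVec (Fin.tail x) = 0 := fun x => by
    conv_lhs => rw [← Fin.cons_self_tail x]
    rw [mulVec_bord_cons_eq_zero]
    simp
  have e : {x // (bord a 0 B).mulVec x = 0} ≃ {x : F // a * x = 0} × {y // B.mulVec y = 0} :=
    { toFun := fun x => (⟨x.1 0, ((hker _).1 x.2).1⟩, ⟨Fin.tail x.1, ((hker _).1 x.2).2⟩)
      invFun := fun p => ⟨Fin.cons p.1.1 p.2.1, (hker _).2 ⟨p.1.2, p.2.2⟩⟩
      left_inv := fun x => Subtype.ext (Fin.cons_self_tail _)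
      right_inv := fun p => rfl }
  have hc := Nat.card_congr e
  rw [Nat.card_prod] at hc
  split_ifs with ha
  · subst ha
    have h1 : Nat.card {x : F // 0 * x = 0} = Fintype.card F := by
      rw [← Nat.card_eq_fintype_card]
      exact Nat.card_congr (Equiv.subtypeUnivEquiv fun x => zero_mul x)
    have := rank_eq_of_card_ker (bord 0 0 B) B (c := 0) (d := 1) (by rw [hc, h1]; ring)
    omega
  · have h1 : Nat.card {x : F // a * x = 0} = 1 := by
      rw [Nat.card_eq_one_iff_unique]
      exact ⟨⟨fun x y => Subtype.ext (by simpa [ha] using x.2.trans y.2.symm)⟩, ⟨0, by simp⟩⟩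
    have := rank_eq_of_card_ker (bord a 0 B) B (c := 0) (d := 0)
      (by rw [hc, h1]; ring)
    omega

/-- Shear of the coordinates `(x, y)` along the first coordinate. -/
def shear (w : Fin n → F) : (Fin (n + 1) → F) ≃+ (Fin (n + 1) → F) where
  toFun x := Fin.cons (x 0) (Fin.tail x + x 0 • w)
  invFun x := Fin.cons (x 0) (Fin.tail x - x 0 • w)
  left_inv x := by
    simp only [Fin.cons_zero, Fin.tail_cons, add_sub_cancel_right, Fin.cons_self_tail]
  right_inv x := by
    simp only [Fin.cons_zero, Fin.tail_cons, sub_add_cancel, Fin.cons_self_tail]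
  map_add' x y := by
    ext i
    refine Fin.cases ?_ (fun i => ?_) i
    · simp
    · simp [Fin.tail]
      ring

/-- Shear of the coordinates `(x, y)` adding a linear form in `y` to `x`. -/
def coshear (v : Fin n → F) : (Fin (n + 1) → F) ≃+ (Fin (n + 1) → F) where
  toFun x := Fin.cons (x 0 + v ⬝ᵥ Fin.tail x) (Fin.tail x)
  invFun x := Fin.cons (x 0 - v ⬝ᵥ Fin.tail x) (Fin.tail x)
  left_inv x := by
    simp only [Fin.cons_zero, Fin.tail_cons, add_sub_cancel_right, Fin.cons_self_tail]
  right_inv x := by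
    simp only [Fin.cons_zero, Fin.tail_cons, sub_add_cancel, Fin.cons_self_tail]
  map_add' x y := by
    have : Fin.tail (x + y) = Fin.tail x + Fin.tail y := rfl
    ext i
    refine Fin.cases ?_ (fun i => ?_) i
    · simp [this]
      ring
    · simp [Fin.tail]

theorem quadVal_bord_mulVec_eq_shear {B : Matrix (Fin n) (Fin n) F} (hB : B.IsSymm) (a : F)
    (w : Fin n → F) (x : Fin (n + 1) → F) :
    quadVal (bord a (B.mulVec w) B) x =
      quadVal (bord (a - quadVal B w) 0 B) (shear w x) := by
  conv_lhs => rw [← Fin.cons_self_tail x]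
  rw [quadVal_bord_mulVec hB]
  simp [shear, quadVal_bord]

/-- The shear by `w` makes the form block diagonal with corner `a - quadVal B w`. -/
theorem rank_bord_mulVec (h2 : (2 : F) ≠ 0) {B : Matrix (Fin n) (Fin n) F} (hB : B.IsSymm)
    (a : F) (w : Fin n → F) [Decidable (a = quadVal B w)] :
    (bord a (B.mulVec w) B).rank = B.rank + if a = quadVal B w then 0 else 1 := by
  classical
  rw [rank_eq_of_quadVal_comp h2 (bord_isSymm hB) (bord_isSymm hB) (shear w)
    (quadVal_bord_mulVec_eq_shear hB a w), rank_bord_zero]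
  simp only [sub_eq_zero]

/-- The kernel consists of the vectors (0, y) with y in the hyperplane v ⬝ᵥ y = 0 of ker B. The size
grows by one and the nullity drops by one, so the rank grows by two. -/
theorem rank_bord_of_notMem (a : F) {B : Matrix (Fin n) (Fin n) F} (hB : B.IsSymm)
    {v : Fin n → F} (hv : v ∉ Set.range B.mulVec) :
    (bord a v B).rank = B.rank + 2 := by
  obtain ⟨z, hz, hvz⟩ := exists_mulVec_eq_zero_dotProduct_eq_one hB hv
  have hker : ∀ x : Fin (n + 1) → F, (bord a v B).mulVec x = 0 ↔
      x 0 = 0 ∧ v ⬝ᵥ Fin.tail x = 0 ∧ B.mulVec (Fin.tail x) = 0 := fun x => by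
    conv_lhs => rw [← Fin.cons_self_tail x]
    rw [mulVec_bord_cons_eq_zero]
    constructor
    · rintro ⟨h1, h2⟩
      have h0 : x 0 = 0 := by
        by_contra h0
        refine hv ⟨-(x 0)⁻¹ • Fin.tail x, ?_⟩
        rw [Matrix.mulVec_smul, eq_neg_of_add_eq_zero_right h2, smul_neg, neg_smul, neg_neg,
          smul_smul, inv_mul_cancel₀ h0, one_smul]
      simp_all
    · rintro ⟨h0, h1, h2⟩
      simp [h0, h1, h2]
  -- The line through `z` complements this hyperplane in ker B.
  have e : {x // (bord a v B).mulVec x = 0} × F ≃ {y // B.mulVec y = 0} :=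
    { toFun := fun p => ⟨Fin.tail p.1.1 + p.2 • z, by
        rw [Matrix.mulVec_add, Matrix.mulVec_smul, hz, ((hker _).1 p.1.2).2.2]; simp⟩
      invFun := fun y => (⟨Fin.cons 0 (y.1 - (v ⬝ᵥ y.1) • z), (hker _).2 (by
        refine ⟨rfl, ?_, ?_⟩
        · simp [hvz]
        · rw [Fin.tail_cons, Matrix.mulVec_sub, Matrix.mulVec_smul, hz, y.2]; simp)⟩, v ⬝ᵥ y.1)
      left_inv := fun p => by
        obtain ⟨h0, h1, h2⟩ := (hker _).1 p.1.2
        refine Prod.ext (Subtype.ext ?_) ?_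
        · simp only [dotProduct_add, h1, dotProduct_smul, hvz]
          conv_rhs => rw [← Fin.cons_self_tail p.1.1, h0]
          simp
        · simp [h1, hvz]
      right_inv := fun y => Subtype.ext (by simp) }
  have hc := Nat.card_congr e
  rw [Nat.card_prod, Nat.card_eq_fintype_card (α := F)] at hc
  have := rank_eq_of_card_ker (bord a v B) B (c := 1) (d := 0) (by rw [← hc]; ring)
  omega

end Rank

/-! ### Sums along linear maps -/

section FibreSums

variable {F : Type*} [Field F] [Fintype F]

theorem sum_fin_succ_fun {R : Type*} [AddCommMonoid R] {n : ℕ} (f : (Fin (n + 1) → F) → R) :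
    ∑ x, f x = ∑ a : F, ∑ y : Fin n → F, f (Fin.cons a y) := by
  rw [← Fintype.sum_prod_type']
  exact (Fintype.sum_equiv (Fin.consEquiv fun _ => F) _ _ fun p => rfl).symm

/-- Summing a function along a linear map counts every point of the range equally often. -/
theorem sum_comp_linearMap {V W R : Type*} [AddCommGroup V] [Module F V] [Fintype V]
    [AddCommGroup W] [Module F W] [Fintype W] [CommRing R] (L : V →ₗ[F] W) (f : W → R)
    [DecidablePred (· ∈ LinearMap.range L)] :
    (Fintype.card F : R) ^ Module.finrank F (LinearMap.range L) * ∑ x, f (L x) =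
      (Fintype.card F : R) ^ Module.finrank F V *
        ∑ y with y ∈ LinearMap.range L, f y := by
  classical
  have h1 : ∀ y ∈ LinearMap.range L,
      Fintype.card {x // L x = y} = Fintype.card F ^ Module.finrank F (LinearMap.ker L) := by
    rintro _ ⟨x₀, rfl⟩
    rw [← Nat.card_eq_fintype_card (α := F), ← Module.natCard_eq_pow_finrank,
      ← Nat.card_eq_fintype_card]
    exact Nat.card_congr
      { toFun := fun x => ⟨x.1 - x₀, by simp [x.2]⟩
        invFun := fun k => ⟨k.1 + x₀, by simp⟩
        left_inv := fun x => by simp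
        right_inv := fun k => by simp }
  have h2 : ∑ x, f (L x) = (Fintype.card F : R) ^ Module.finrank F (LinearMap.ker L) *
      ∑ y with y ∈ LinearMap.range L, f y := by
    rw [← Finset.sum_fiberwise_of_maps_to (s := Finset.univ)
      (t := Finset.univ.filter (· ∈ LinearMap.range L)) (g := L) (by simp), Finset.mul_sum]
    refine Finset.sum_congr rfl fun y hy => ?_
    rw [Finset.sum_congr rfl (g := fun _ => f y) (by simp +contextual), Finset.sum_const,
      nsmul_eq_mul, ← Fintype.card_subtype, h1 y (by simpa using hy), Nat.cast_pow]
  rw [h2, ← mul_assoc, ← pow_add, LinearMap.finrank_range_add_finrank_ker]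

end FibreSums

/-! ### Exponential sums of quadratic forms and Gauss sums -/

section CharSums

variable {F : Type*} [Field F] [Fintype F]

/-- The exponential sum of the quadratic form of a matrix. -/
noncomputable def quadSum (ψ : AddChar F ℂ) {m : ℕ} (s : F) (A : Matrix (Fin m) (Fin m) F) : ℂ :=
  ∑ x, ψ (s * quadVal A x)

/-- The exponential sum of a quadratic form in one variable. -/
noncomputable def sqSum (ψ : AddChar F ℂ) (c : F) : ℂ := ∑ x, ψ (c * x ^ 2)

variable {ψ : AddChar F ℂ} {n m : ℕ}

@[simp] theorem sqSum_zero : sqSum ψ 0 = Fintype.card F := by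
  simp [sqSum]

theorem quadSum_comp {A A' : Matrix (Fin m) (Fin m) F} (L : (Fin m → F) ≃+ (Fin m → F))
    (h : ∀ x, quadVal A' x = quadVal A (L x)) (s : F) : quadSum ψ s A' = quadSum ψ s A :=
  Fintype.sum_equiv L.toEquiv _ _ fun x => by simp [h]

theorem quadSum_bord_zero (s a : F) (B : Matrix (Fin n) (Fin n) F) :
    quadSum ψ s (bord a 0 B) = sqSum ψ (s * a) * quadSum ψ s B := by
  simp only [quadSum, sqSum, sum_fin_succ_fun, Finset.sum_mul_sum, quadVal_bord]
  refine Finset.sum_congr rfl fun x _ => Finset.sum_congr rfl fun y _ => ?_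
  rw [← AddChar.map_add_eq_mul, zero_dotProduct]
  ring_nf

theorem quadSum_bord_mulVec {B : Matrix (Fin n) (Fin n) F} (hB : B.IsSymm) (s a : F)
    (w : Fin n → F) : quadSum ψ s (bord a (B.mulVec w) B) =
      sqSum ψ (s * (a - quadVal B w)) * quadSum ψ s B := by
  rw [quadSum_comp (shear w) (quadVal_bord_mulVec_eq_shear hB a w), quadSum_bord_zero]

/-- For fixed x ≠ 0, translating y along a kernel vector of B not orthogonal to v multiplies the
inner sum by a character value other than 1, so that sum vanishes. Only x = 0 survives. -/
theorem quadSum_bord_of_notMem (h2 : (2 : F) ≠ 0) (hψ : ψ ≠ 1) (a : F) {s : F} (hs : s ≠ 0)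
    {B : Matrix (Fin n) (Fin n) F} (hB : B.IsSymm) {v : Fin n → F}
    (hv : v ∉ Set.range B.mulVec) : quadSum ψ s (bord a v B) = quadSum ψ s B := by
  obtain ⟨z, hz, hvz⟩ := exists_mulVec_eq_zero_dotProduct_eq_one hB hv
  obtain ⟨τ, hτ⟩ : ∃ τ, ψ τ ≠ 1 := by
    by_contra! h
    exact hψ (by ext; simp [h])
  rw [quadSum, sum_fin_succ_fun, Finset.sum_eq_single 0]
  · simp [quadSum, quadVal_bord]
  · intro x _ hx
    -- With this `c`, moving y by `c • z` changes the exponent by exactly `τ`.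
    set c : F := (s * (2 * x))⁻¹ * τ with hc
    set f : (Fin n → F) → ℂ := fun y => ψ (s * quadVal (bord a v B) (Fin.cons x y)) with hf
    have h1 : ∑ y, f y = ψ τ * ∑ y, f y := by
      rw [Finset.mul_sum]
      refine Fintype.sum_equiv (Equiv.subRight (c • z)) _ _ fun y => ?_
      rw [Equiv.subRight_apply, hf]
      dsimp only
      rw [← AddChar.map_add_eq_mul, quadVal_bord, quadVal_bord, dotProduct_sub,
        dotProduct_smul, hvz]
      have : quadVal B (y - c • z) = quadVal B y := by
        rw [sub_eq_add_neg]
        exact quadVal_add_of_mulVec_eq_zero hB y (by simp [Matrix.mulVec_neg,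
          Matrix.mulVec_smul, hz])
      rw [this, smul_eq_mul, mul_one]
      have h3 : s * (2 * x) * c = τ := by
        rw [hc, mul_inv_cancel_left₀ (mul_ne_zero hs (mul_ne_zero h2 hx))]
      congr 1
      linear_combination h3
    have h3 : (1 - ψ τ) * ∑ y, f y = 0 := by linear_combination h1
    exact (mul_eq_zero.1 h3).resolve_left (sub_ne_zero.2 hτ.symm)
  · simp

variable [DecidableEq F]

/-- The Gauss sum of the quadratic character. -/
noncomputable def quadGauss (ψ : AddChar F ℂ) : ℂ :=
  gaussSum ((quadraticChar F).ringHomComp (Int.castRingHom ℂ)) ψ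

theorem quadGauss_sq (hF : ringChar F ≠ 2) (hψ : ψ.IsPrimitive) :
    quadGauss ψ ^ 2 = (quadraticChar F (-1) : ℂ) * Fintype.card F := by
  rw [quadGauss, gaussSum_sq _ _ hψ]
  · simp
  · intro h
    obtain ⟨a, ha⟩ := quadraticChar_exists_neg_one' hF
    have := congrArg (fun χ : MulChar F ℂ => χ a) h
    simp [ha] at this
    norm_num at this
  · exact (quadraticChar_isQuadratic F).comp _

theorem sum_mul_quadraticChar (hF : ringChar F ≠ 2) (a : F) :
    ∑ s : F, (quadraticChar F s : ℂ) * ψ (s * a) = quadraticChar F a * quadGauss ψ := by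
  rcases eq_or_ne a 0 with rfl | ha
  · have := quadraticChar_sum_zero hF
    simp only [mul_zero, AddChar.map_zero_eq_one, mul_one, quadraticChar_zero, Int.cast_zero,
      zero_mul]
    exact_mod_cast this
  · have hsq : (quadraticChar F a : ℂ) * quadraticChar F a = 1 := by
      have := quadraticChar_sq_one ha
      rw [sq] at this
      exact_mod_cast this
    rw [quadGauss, gaussSum, Finset.mul_sum]
    refine Fintype.sum_equiv (Equiv.mulRight₀ a ha) _ _ fun s => ?_
    simp only [Equiv.mulRight₀_apply, MulChar.ringHomComp_apply, map_mul, eq_intCast]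
    linear_combination (-(quadraticChar F s : ℂ) * ψ (s * a)) * hsq

/-- An element y has 1 + η(y) square roots, η being the quadratic character; the constant 1
contributes zero because c ≠ 0. -/
theorem sqSum_eq (hF : ringChar F ≠ 2) (hψ : ψ.IsPrimitive) {c : F} (hc : c ≠ 0) :
    sqSum ψ c = quadraticChar F c * quadGauss ψ := by
  have h1 : sqSum ψ c = ∑ y : F, ((quadraticChar F y : ℂ) + 1) * ψ (y * c) := by
    rw [sqSum, ← Finset.sum_fiberwise_of_maps_to (s := Finset.univ)
      (t := Finset.univ) (g := fun x : F => x ^ 2) (by simp)]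
    refine Finset.sum_congr rfl fun y _ => ?_
    rw [Finset.sum_congr rfl (g := fun _ => ψ (y * c)) (by
      intro x hx
      rw [← (Finset.mem_filter.1 hx).2, mul_comm]), Finset.sum_const, nsmul_eq_mul]
    congr 1
    have := quadraticChar_card_sqrts hF y
    rw [show ({x : F | x ^ 2 = y} : Set F).toFinset = Finset.univ.filter fun x => x ^ 2 = y by
      ext; simp] at this
    exact_mod_cast this
  have h2 : ∑ y : F, ψ (y * c) = 0 := by
    rw [AddChar.sum_mulShift c hψ, if_neg hc, Nat.cast_zero]
  rw [h1]
  simp only [add_mul, one_mul, Finset.sum_add_distrib, h2, add_zero]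
  exact sum_mul_quadraticChar hF c

theorem sum_sqSum_ne_zero (hF : ringChar F ≠ 2) (hψ : ψ.IsPrimitive) :
    ∑ a : F with a ≠ 0, sqSum ψ a = 0 := by
  rw [Finset.sum_congr rfl (g := fun a => (quadraticChar F a : ℂ) * quadGauss ψ)
    (fun a ha => sqSum_eq hF hψ (Finset.mem_filter.1 ha).2), ← Finset.sum_mul,
    Finset.sum_filter_of_ne (by
      intro a _ h
      contrapose! h
      simp [h])]
  have := quadraticChar_sum_zero hF
  have h : ∑ a : F, (quadraticChar F a : ℂ) = 0 := by exact_mod_cast this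
  rw [h, zero_mul]

/-- The exponential sums of the scalar multiples of a symmetric matrix of rank `r`. -/
theorem exists_quadSum_eq (hF : ringChar F ≠ 2) (hψ : ψ.IsPrimitive) :
    ∀ {m : ℕ} {A : Matrix (Fin m) (Fin m) F}, A.IsSymm → ∃ σ : ℂ, σ ^ 2 = 1 ∧ ∀ s ≠ 0,
      quadSum ψ s A * (Fintype.card F : ℂ) ^ A.rank =
        (Fintype.card F : ℂ) ^ m * σ * (quadraticChar F s : ℂ) ^ A.rank *
          quadGauss ψ ^ A.rank := by
  have h2 : (2 : F) ≠ 0 := Ring.two_ne_zero hF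
  have hψ1 : ψ ≠ 1 := by
    have := hψ one_ne_zero
    simpa using this
  have hη : ∀ a : F, a ≠ 0 → (quadraticChar F a : ℂ) ^ 2 = 1 := fun a ha => by
    exact_mod_cast quadraticChar_sq_one ha
  intro m
  induction m with
  | zero =>
    intro A _
    refine ⟨1, by norm_num, fun s _ => ?_⟩
    have : A.rank = 0 := Nat.le_zero.1 (A.rank_le_height)
    simp [this, quadSum, quadVal]
  | succ n ih =>
    intro A hA
    rw [eq_bord hA]
    have hB := hA.submatrix (Fin.succ (n := n))
    generalize A.submatrix Fin.succ Fin.succ = B at *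
    generalize (fun j : Fin n => A 0 j.succ) = v
    generalize A 0 0 = a
    obtain ⟨σ, hσ, h⟩ := ih hB
    by_cases hv : v ∈ Set.range B.mulVec
    · obtain ⟨w, rfl⟩ := hv
      rw [rank_bord_mulVec h2 hB]
      split_ifs with ha
      · refine ⟨σ, hσ, fun s hs => ?_⟩
        rw [quadSum_bord_mulVec hB, ha, sub_self, mul_zero, sqSum_zero, mul_assoc, add_zero,
          h s hs]
        ring
      · refine ⟨σ * quadraticChar F (a - quadVal B w), ?_, fun s hs => ?_⟩
        · rw [mul_pow, hσ, hη _ (sub_ne_zero.2 ha), one_mul]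
        · rw [quadSum_bord_mulVec hB, sqSum_eq hF hψ (mul_ne_zero hs (sub_ne_zero.2 ha)),
            map_mul, Int.cast_mul]
          linear_combination (quadraticChar F s * quadraticChar F (a - quadVal B w) *
            quadGauss ψ * Fintype.card F) * h s hs
    · rw [rank_bord_of_notMem a hB hv]
      -- The rank rises by two, and the new sign compensates for the factor η(-1) in the square of
      -- the Gauss sum.
      refine ⟨σ * quadraticChar F (-1), ?_, fun s hs => ?_⟩
      · rw [mul_pow, hσ, hη _ (by simp), one_mul]
      · rw [quadSum_bord_of_notMem h2 hψ1 a hs hB hv, pow_add, ← mul_assoc, h s hs,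
          pow_add (quadraticChar F s : ℂ), pow_add (quadGauss ψ), quadGauss_sq hF hψ, hη s hs]
        linear_combination (-(Fintype.card F : ℂ) ^ (n + 2) * σ *
          (quadraticChar F s : ℂ) ^ B.rank * quadGauss ψ ^ B.rank) * hη (-1) (by simp)

end CharSums

/-! ### Linearly independent linear forms -/

section LinearForms

variable {F : Type*} [Field F]

/-- A non-zero functional vanishing on the range would be a linear relation among the forms. -/
theorem surjective_pi_of_linearIndependent {ι V : Type*} [Finite ι] [AddCommGroup V]
    [Module F V] {X : ι → Module.Dual F V} (hX : LinearIndependent F X) :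
    Function.Surjective (LinearMap.pi X) := by
  classical
  cases nonempty_fintype ι
  rw [← LinearMap.range_eq_top]
  by_contra h
  obtain ⟨f, hf0, hf⟩ := Submodule.exists_le_ker_of_lt_top _ (lt_top_iff_ne_top.2 h)
  refine hf0 (LinearMap.ext fun u => ?_)
  have hfu : ∀ u : ι → F, f u = ∑ i, f (Pi.single i 1) * u i := fun u => by
    conv_lhs => rw [LinearMap.pi_apply_eq_sum_univ f u]
    refine Finset.sum_congr rfl fun i _ => ?_
    rw [smul_eq_mul, mul_comm]
    congr 2
    ext j
    simp [Pi.single_apply, eq_comm]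
  have h0 := Fintype.linearIndependent_iff.1 hX (fun i => f (Pi.single i 1)) (by
    ext x
    have := hf (LinearMap.mem_range_self (LinearMap.pi X) x)
    rw [LinearMap.mem_ker, hfu] at this
    simpa using this)
  rw [hfu]
  simp [h0]

theorem linearIndependent_of_surjective_pi {ι V : Type*} [Finite ι] [AddCommGroup V]
    [Module F V] {X : ι → Module.Dual F V} (hX : Function.Surjective (LinearMap.pi X)) :
    LinearIndependent F X := by
  classical
  cases nonempty_fintype ι
  refine Fintype.linearIndependent_iff.2 fun g hg i => ?_
  obtain ⟨x, hx⟩ := hX (Pi.single i 1)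
  have := LinearMap.congr_fun hg x
  have hx' : ∀ j, X j x = (Pi.single i 1 : ι → F) j := fun j => congrFun hx j
  simpa [hx', Pi.single_apply] using this

/-- If a quadratic form factors through as many linear forms as its rank, then these are
linearly independent. -/
theorem linearIndependent_of_quadVal_eq (h2 : (2 : F) ≠ 0) {ι : Type*} [Fintype ι] {m : ℕ}
    {A : Matrix (Fin m) (Fin m) F} (hA : A.IsSymm) (hr : A.rank = Fintype.card ι)
    (X : ι → Module.Dual F (Fin m → F)) (P : (ι → F) → F)
    (h : ∀ x, quadVal A x = P fun i => X i x) : LinearIndependent F X := by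
  refine linearIndependent_of_surjective_pi (LinearMap.range_eq_top.1 ?_)
  -- A common zero of the forms lies in the radical; comparing dimensions then makes the joint map
  -- surjective.
  have hle : LinearMap.ker (LinearMap.pi X) ≤ LinearMap.ker A.mulVecLin := fun z hz => by
    refine mulVec_eq_zero_of_forall_quadVal_add h2 hA fun x => ?_
    rw [h, h]
    congr 1
    ext i
    have : X i z = 0 := congrFun (LinearMap.mem_ker.1 hz) i
    rw [map_add, this, add_zero]
  have h1 := Submodule.finrank_mono hle
  have h3 := LinearMap.finrank_range_add_finrank_ker A.mulVecLin
  have h4 := LinearMap.finrank_range_add_finrank_ker (LinearMap.pi X)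
  refine Submodule.eq_top_of_finrank_eq (le_antisymm (Submodule.finrank_le _) ?_)
  rw [Module.finrank_fintype_fun_eq_card, ← hr, Matrix.rank]
  omega

end LinearForms

/-! ### Exponential sums of hyperbolic and elliptic forms -/

section TypeSums

variable {F : Type*} [Field F] [Fintype F] {ψ : AddChar F ℂ}

theorem sum_comp_linearIndependent {ι R : Type*} [Fintype ι] [DecidableEq ι] [CommRing R]
    {m : ℕ} {X : ι → Module.Dual F (Fin m → F)} (hX : LinearIndependent F X)
    (f : (ι → F) → R) :
    (∑ x, f fun i => X i x) * (Fintype.card F : R) ^ Fintype.card ι =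
      (Fintype.card F : R) ^ m * ∑ u, f u := by
  classical
  have hs := LinearMap.range_eq_top.2 (surjective_pi_of_linearIndependent hX)
  have := sum_comp_linearMap (LinearMap.pi X) f
  rw [hs, finrank_top, Module.finrank_fintype_fun_eq_card, Module.finrank_fin_fun] at this
  rw [mul_comm]
  rw [Finset.filter_true_of_mem fun _ _ => Submodule.mem_top] at this
  exact this

theorem sum_pairs_eq_prod {t : ℕ} (G : Fin t → F → F → ℂ) :
    ∑ u : Fin t × Fin 2 → F, ∏ i, G i (u (i, 0)) (u (i, 1)) =
      ∏ i, ∑ x : F, ∑ y : F, G i x y := by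
  have h : ∀ i, ∑ x : F, ∑ y : F, G i x y = ∑ p : Fin 2 → F, G i (p 0) (p 1) := fun i => by
    rw [← Fintype.sum_prod_type']
    exact Fintype.sum_equiv (finTwoArrowEquiv F).symm _ _ fun p => by simp
  simp only [h]
  rw [Finset.prod_univ_sum, Fintype.piFinset_univ]
  exact Fintype.sum_equiv (Equiv.curry _ _ _) _ _ fun u => rfl

theorem AddChar.map_finset_sum_eq_prod {ι : Type*} (s : Finset ι) (f : ι → F) :
    ψ (∑ i ∈ s, f i) = ∏ i ∈ s, ψ (f i) := by
  classical
  induction s using Finset.induction_on with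
  | empty => simp
  | insert a s ha ih => rw [Finset.sum_insert ha, Finset.prod_insert ha,
      AddChar.map_add_eq_mul, ih]

theorem sum_hyperbolicPlane (hψ : ψ.IsPrimitive) {c : F} (hc : c ≠ 0) :
    ∑ x : F, ∑ y : F, ψ (c * (x * y)) = Fintype.card F := by
  classical
  have : ∀ x : F, ∑ y : F, ψ (c * (x * y)) = if x = 0 then (Fintype.card F : ℂ) else 0 := by
    intro x
    have := AddChar.sum_mulShift (c * x) hψ
    simp only [mul_eq_zero, hc, false_or] at this
    push_cast at this
    rw [← this]
    exact Finset.sum_congr rfl fun y _ => by ring_nf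
  simp [this]

/-- In independent coordinates the sum factors into t hyperbolic planes, each contributing q, times
q^(m-2t) for the free directions; powers are kept on the left to avoid subtraction. -/
theorem quadSum_of_isHyperbolic (hψ : ψ.IsPrimitive) {t m : ℕ}
    {A : Matrix (Fin m) (Fin m) F} (h : IsHyperbolic t A) :
    quadSum ψ 1 A * (Fintype.card F : ℂ) ^ t = (Fintype.card F : ℂ) ^ m := by
  obtain ⟨c, X, hc, hX, h⟩ := h
  have h1 := sum_comp_linearIndependent hX
    fun u => ∏ i : Fin t, ψ (c * (u (i, 0) * u (i, 1)))
  rw [sum_pairs_eq_prod fun _ x y => ψ (c * (x * y))] at h1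
  simp only [sum_hyperbolicPlane hψ hc, Finset.prod_const, Finset.card_univ, Fintype.card_fin,
    Fintype.card_prod] at h1
  have h2 : quadSum ψ 1 A = ∑ x, ∏ i : Fin t, ψ (c * (X (i, 0) x * X (i, 1) x)) := by
    refine Finset.sum_congr rfl fun x _ => ?_
    rw [one_mul, h, Finset.mul_sum, AddChar.map_finset_sum_eq_prod]
  rw [← h2] at h1
  have hq : (Fintype.card F : ℂ) ^ t ≠ 0 := by simp
  refine mul_right_cancel₀ hq ?_
  rw [← h1]
  ring

open MvPolynomial in
/-- A binary quadratic form is determined by three coefficients. -/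
theorem MvPolynomial.IsHomogeneous.exists_eq_binary {f : MvPolynomial (Fin 2) F}
    (hf : f.IsHomogeneous 2) :
    ∃ a b c : F, f = C a * X 0 ^ 2 + C b * (X 0 * X 1) + C c * X 1 ^ 2 := by
  refine ⟨f.coeff (Finsupp.single 0 2), f.coeff (Finsupp.single 0 1 + Finsupp.single 1 1),
    f.coeff (Finsupp.single 1 2), ?_⟩
  have hX : (X 0 * X 1 : MvPolynomial (Fin 2) F) =
      monomial (Finsupp.single 0 1 + Finsupp.single 1 1) 1 := by
    rw [X, X, monomial_mul, one_mul]
  rw [hX, C_mul_monomial, C_mul_X_pow_eq_monomial, C_mul_X_pow_eq_monomial, mul_one]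
  ext m
  by_cases hm : m 0 + m 1 = 2
  · obtain h | h | h : (m 0 = 2 ∧ m 1 = 0) ∨ (m 0 = 1 ∧ m 1 = 1) ∨ (m 0 = 0 ∧ m 1 = 2) := by
      omega
    · obtain rfl : m = Finsupp.single 0 2 := by ext i; fin_cases i <;> simp [h]
      simp [coeff_monomial, Finsupp.ext_iff, Fin.forall_fin_two]
    · obtain rfl : m = Finsupp.single 0 1 + Finsupp.single 1 1 := by
        ext i; fin_cases i <;> simp [h]
      simp [coeff_monomial, Finsupp.ext_iff, Fin.forall_fin_two]
    · obtain rfl : m = Finsupp.single 1 2 := by ext i; fin_cases i <;> simp [h]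
      simp [coeff_monomial, Finsupp.ext_iff, Fin.forall_fin_two]
  · rw [hf.coeff_eq_zero (by simpa [Finsupp.degree_eq_sum, Fin.sum_univ_two] using hm)]
    simp only [coeff_add, coeff_monomial, Finsupp.ext_iff, Fin.forall_fin_two]
    rw [if_neg, if_neg, if_neg, add_zero, add_zero] <;> simp <;> omega

open MvPolynomial in
theorem not_irreducible_of_discrim_eq_sq (h2 : (2 : F) ≠ 0) {a b c e : F}
    (he : b ^ 2 - 4 * a * c = e ^ 2) :
    ¬ Irreducible (C a * X 0 ^ 2 + C b * (X 0 * X 1) + C c * X 1 ^ 2 :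
      MvPolynomial (Fin 2) F) := by
  have hu : ∀ x y : F, ¬ IsUnit (C x * X 0 + C y * X 1 : MvPolynomial (Fin 2) F) :=
    fun x y h => by simpa using h.map (constantCoeff (R := F) (σ := Fin 2))
  intro h
  by_cases ha : a = 0
  · subst ha
    have : (C 0 * X 0 ^ 2 + C b * (X 0 * X 1) + C c * X 1 ^ 2 : MvPolynomial (Fin 2) F) =
        (C 0 * X 0 + C 1 * X 1) * (C b * X 0 + C c * X 1) := by
      simp only [C_0, C_1]; ring
    exact (h.isUnit_or_isUnit this).elim (hu _ _) (hu _ _)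
  · have : (C a * X 0 ^ 2 + C b * (X 0 * X 1) + C c * X 1 ^ 2 : MvPolynomial (Fin 2) F) =
        (C a * X 0 + C ((b - e) / 2) * X 1) * (C 1 * X 0 + C ((b + e) / (2 * a)) * X 1) := by
      have h1 : b = a * ((b + e) / (2 * a)) + (b - e) / 2 := by field_simp; ring
      have h3 : c = (b - e) / 2 * ((b + e) / (2 * a)) := by
        field_simp
        linear_combination -he
      have h1' := congrArg (C (σ := Fin 2)) h1
      have h3' := congrArg (C (σ := Fin 2)) h3
      rw [C_add, C_mul] at h1'
      rw [C_mul] at h3'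
      rw [C_1]
      linear_combination (X 0 * X 1) * h1' + X 1 ^ 2 * h3'
    exact (h.isUnit_or_isUnit this).elim (hu _ _) (hu _ _)

open MvPolynomial in
-- Up to a unit this is a monic quadratic in the first variable over polynomials in the second. A
-- root, evaluated at 1, would be a square root of -b / a.
theorem irreducible_of_not_isSquare {a b : F} (ha : a ≠ 0) (h : ¬ IsSquare (-b / a)) :
    Irreducible (C a * X 0 ^ 2 + C b * X 1 ^ 2 : MvPolynomial (Fin 2) F) := by
  have hu : IsUnit (C a : MvPolynomial (Fin 2) F) := ha.isUnit.map C
  have : (C a * X 0 ^ 2 + C b * X 1 ^ 2 : MvPolynomial (Fin 2) F) =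
      C a * (X 0 ^ 2 + C (b / a) * X 1 ^ 2) := by
    rw [mul_add, ← mul_assoc (C a) (C (b / a)), ← C_mul, mul_div_cancel₀ _ ha]
  rw [this, irreducible_isUnit_mul hu,
    ← MulEquiv.irreducible_iff (finSuccEquiv F 1)]
  have h1 : finSuccEquiv F 1 (X 0 ^ 2 + C (b / a) * X 1 ^ 2) =
      Polynomial.X ^ 2 + Polynomial.C (C (b / a) * X 0 ^ 2) := by
    have : (1 : Fin 2) = Fin.succ 0 := rfl
    rw [map_add, map_mul, map_pow, map_pow, finSuccEquiv_X_zero, this, finSuccEquiv_X_succ]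
    simp [finSuccEquiv_apply]
  rw [h1]
  have hm := Polynomial.monic_X_pow_add_C (C (b / a) * X 0 ^ 2 : MvPolynomial (Fin 1) F)
    two_ne_zero
  have hd := Polynomial.natDegree_X_pow_add_C (n := 2)
    (r := (C (b / a) * X 0 ^ 2 : MvPolynomial (Fin 1) F))
  rw [hm.irreducible_iff_roots_eq_zero_of_degree_le_three hd.ge (by omega)]
  refine Multiset.eq_zero_of_forall_notMem fun r hr => h ⟨eval (fun _ => 1) r, ?_⟩
  have hr := Polynomial.isRoot_of_mem_roots hr
  have := congrArg (eval fun _ => (1 : F)) hr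
  simp at this
  rw [neg_div]
  linear_combination -this

variable [DecidableEq F]

/-- The exponential sum of an irreducible binary quadratic form. -/
theorem sum_irreducible_binary (hF : ringChar F ≠ 2) (hψ : ψ.IsPrimitive)
    {f : MvPolynomial (Fin 2) F} (hf : f.IsHomogeneous 2) (hi : Irreducible f) {c : F}
    (hc : c ≠ 0) :
    ∑ x : F, ∑ y : F, ψ (c * MvPolynomial.eval ![x, y] f) = -(Fintype.card F : ℂ) := by
  have h2 : (2 : F) ≠ 0 := Ring.two_ne_zero hF
  obtain ⟨α, β, γ, rfl⟩ := hf.exists_eq_binary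
  have hns : ¬ IsSquare (β ^ 2 - 4 * α * γ) := by
    rintro ⟨e, he⟩
    exact not_irreducible_of_discrim_eq_sq h2 (he.trans (sq e).symm) hi
  have hα : α ≠ 0 := by
    rintro rfl
    exact hns ⟨β, by ring⟩
  set D := β ^ 2 - 4 * α * γ with hD
  have hD0 : D ≠ 0 := fun h => hns (h ▸ IsSquare.zero)
  have h1 : ∑ x : F, ∑ y : F, ψ (c * MvPolynomial.eval ![x, y] (MvPolynomial.C α *
      MvPolynomial.X 0 ^ 2 + MvPolynomial.C β * (MvPolynomial.X 0 * MvPolynomial.X 1) +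
      MvPolynomial.C γ * MvPolynomial.X 1 ^ 2)) =
      sqSum ψ (c * α) * sqSum ψ (-(c * α) * D * (2 * α)⁻¹ ^ 2) := by
    rw [mul_comm (sqSum ψ (c * α)), sqSum, sqSum, Finset.sum_mul_sum, Finset.sum_comm]
    refine Finset.sum_congr rfl fun y _ => ?_
    -- Translating x by a multiple of y completes the square, leaving a multiple of y² governed by
    -- the discriminant.
    refine Fintype.sum_equiv (Equiv.addRight (β / (2 * α) * y)) _ _ fun x => ?_
    rw [← AddChar.map_add_eq_mul, Equiv.coe_addRight]
    congr 1
    simp [hD]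
    field_simp
    ring
  have hα2 : (2 * α)⁻¹ ≠ 0 := inv_ne_zero (mul_ne_zero h2 hα)
  have hη : ∀ a : F, a ≠ 0 → (quadraticChar F a : ℂ) ^ 2 = 1 := fun a ha => by
    exact_mod_cast quadraticChar_sq_one ha
  have hηD : (quadraticChar F D : ℂ) = -1 := by
    have := quadraticChar_neg_one_iff_not_isSquare.2 hns
    exact_mod_cast this
  rw [h1, sqSum_eq hF hψ (mul_ne_zero hc hα), sqSum_eq hF hψ (by simp; tauto)]
  have h5 := hη (c * α) (mul_ne_zero hc hα)
  generalize c * α = e at h5 ⊢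
  have h3 : -e * D * (2 * α)⁻¹ ^ 2 = -1 * e * D * (2 * α)⁻¹ ^ 2 := by ring
  rw [h3, map_mul, map_mul, map_mul, map_pow]
  push_cast
  rw [hη _ hα2, hηD]
  have h4 := quadGauss_sq hF hψ
  have h6 := hη (-1) (by simp)
  linear_combination (-(quadraticChar F e : ℂ) ^ 2 * quadraticChar F (-1)) * h4 -
    (quadraticChar F (-1) : ℂ) ^ 2 * Fintype.card F * h5 - (Fintype.card F : ℂ) * h6

/-- As in the hyperbolic case, except that one plane contributes -q in place of q. -/
theorem quadSum_of_isElliptic (hF : ringChar F ≠ 2) (hψ : ψ.IsPrimitive) {t m : ℕ}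
    {A : Matrix (Fin m) (Fin m) F} (h : IsElliptic t A) :
    quadSum ψ 1 A * (Fintype.card F : ℂ) ^ t = -(Fintype.card F : ℂ) ^ m := by
  obtain ⟨s, c, f, X, rfl, hc, hf, hi, hX, h⟩ := h
  set G : Fin (s + 1) → F → F → ℂ := Fin.cons (fun x y => ψ (c * MvPolynomial.eval ![x, y] f))
    fun _ x y => ψ (c * (x * y)) with hG
  have h1 := sum_comp_linearIndependent hX
    fun u => ∏ i : Fin (s + 1), G i (u (i, 0)) (u (i, 1))
  rw [sum_pairs_eq_prod G, Fin.prod_univ_succ] at h1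
  simp only [hG, Fin.cons_zero, Fin.cons_succ, sum_hyperbolicPlane hψ hc,
    sum_irreducible_binary hF hψ hf hi hc, Finset.prod_const, Finset.card_univ,
    Fintype.card_fin, Fintype.card_prod, Fin.prod_univ_succ] at h1
  have h2 : quadSum ψ 1 A = ∑ x, ψ (c * MvPolynomial.eval ![X (0, 0) x, X (0, 1) x] f) *
      ∏ i : Fin s, ψ (c * (X (i.succ, 0) x * X (i.succ, 1) x)) := by
    refine Finset.sum_congr rfl fun x _ => ?_
    have : (fun j => X (0, j) x) = ![X (0, 0) x, X (0, 1) x] := by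
      ext j; fin_cases j <;> rfl
    rw [one_mul, h, mul_add, Finset.mul_sum, AddChar.map_add_eq_mul,
      AddChar.map_finset_sum_eq_prod, this]
  rw [← h2] at h1
  have hq : (Fintype.card F : ℂ) ^ (s + 1) ≠ 0 := by simp
  refine mul_right_cancel₀ hq ?_
  linear_combination h1

end TypeSums

/-! ### Normal forms over a finite field of odd characteristic -/

section Classification

variable {F : Type*} [Field F]

/-- A function that is a sum of `s` products of two linear forms. -/
def IsHypSum {V : Type*} [AddCommGroup V] [Module F V] (s : ℕ) (f : V → F) : Prop :=
  ∃ X : Fin s × Fin 2 → Module.Dual F V, ∀ x, f x = ∑ i, X (i, 0) x * X (i, 1) x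

namespace IsHypSum

variable {V W : Type*} [AddCommGroup V] [Module F V] [AddCommGroup W] [Module F W] {s : ℕ}

theorem comp {f : W → F} (hf : IsHypSum s f) (L : V →ₗ[F] W) :
    IsHypSum s fun x => f (L x) := by
  obtain ⟨X, hX⟩ := hf
  exact ⟨fun p => X p ∘ₗ L, fun x => hX _⟩

theorem mul_add {f : V → F} (hf : IsHypSum s f) (U U' : Module.Dual F V) :
    IsHypSum (s + 1) fun x => U x * U' x + f x := by
  obtain ⟨X, hX⟩ := hf
  refine ⟨fun p => Fin.cons (α := fun _ => Fin 2 → Module.Dual F V) ![U, U']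
    (fun i j => X (i, j)) p.1 p.2, fun x => ?_⟩
  simp [Fin.sum_univ_succ, hX]

end IsHypSum

theorem isHyperbolic_of_isHypSum (h2 : (2 : F) ≠ 0) {m t : ℕ} {A : Matrix (Fin m) (Fin m) F}
    (hA : A.IsSymm) (hr : A.rank = 2 * t) (h : IsHypSum t (quadVal A)) : IsHyperbolic t A := by
  obtain ⟨X, hX⟩ := h
  refine ⟨1, X, one_ne_zero, ?_, by simpa using hX⟩
  exact linearIndependent_of_quadVal_eq h2 hA (by simp [hr, mul_comm]) X
    (fun u => ∑ i, u (i, 0) * u (i, 1)) hX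

/-- The point (x, y, 1) is isotropic. In the forms X' = X - xZ and Y' = Y - yZ there is no Z² term,
and Z occurs only in 2ZU with U = axX' + byY'. Eliminating X' in favour of U leaves U times a linear
form, plus a multiple of Y'². -/
theorem exists_ternary_of_ne_zero {V : Type*} [AddCommGroup V] [Module F V] {a b c x y : F}
    (ha : a ≠ 0) (hb : b ≠ 0) (hc : c ≠ 0) (hxy : a * x ^ 2 + b * y ^ 2 = -c) (hx : x ≠ 0)
    (X Y Z : Module.Dual F V) :
    ∃ (U U' W : Module.Dual F V) (d : F), d ≠ 0 ∧
      ∀ p, a * X p ^ 2 + b * Y p ^ 2 + c * Z p ^ 2 = U p * U' p + d * W p ^ 2 := by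
  refine ⟨(a * x) • (X - x • Z) + (b * y) • (Y - y • Z),
    (2 : F) • Z + (a * x ^ 2)⁻¹ • ((a * x) • (X - x • Z) + (b * y) • (Y - y • Z)) -
      (2 * b * y * (a * x ^ 2)⁻¹) • (Y - y • Z), Y - y • Z, -(b * c) / (a * x ^ 2), ?_, fun p => ?_⟩
  · exact div_ne_zero (neg_ne_zero.2 (mul_ne_zero hb hc)) (mul_ne_zero ha (pow_ne_zero 2 hx))
  · obtain rfl : c = -(a * x ^ 2 + b * y ^ 2) := by rw [hxy, neg_neg]
    simp only [LinearMap.add_apply, LinearMap.sub_apply, LinearMap.smul_apply, smul_eq_mul]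
    field_simp
    ring

variable [Fintype F]

theorem exists_add_sq_eq (hF : ringChar F ≠ 2) {a b : F} (ha : a ≠ 0) (hb : b ≠ 0) (c : F) :
    ∃ x y, a * x ^ 2 + b * y ^ 2 = c := by
  obtain ⟨x, y, h⟩ := FiniteField.exists_root_sum_quadratic (R := F)
    (f := Polynomial.C a * Polynomial.X ^ 2)
    (g := Polynomial.C b * Polynomial.X ^ 2 + Polynomial.C 0 * Polynomial.X +
      Polynomial.C (-c)) (Polynomial.degree_C_mul_X_pow 2 ha)
    (Polynomial.degree_quadratic hb) (FiniteField.odd_card_of_char_ne_two hF)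
  refine ⟨x, y, ?_⟩
  simp at h
  linear_combination h

/-- A ternary quadratic form over a finite field splits off a product of linear forms. -/
theorem exists_ternary (hF : ringChar F ≠ 2) {V : Type*} [AddCommGroup V] [Module F V]
    {a b c : F} (ha : a ≠ 0) (hb : b ≠ 0) (hc : c ≠ 0) (X Y Z : Module.Dual F V) :
    ∃ (U U' W : Module.Dual F V) (d : F), d ≠ 0 ∧
      ∀ p, a * X p ^ 2 + b * Y p ^ 2 + c * Z p ^ 2 = U p * U' p + d * W p ^ 2 := by
  obtain ⟨x, y, hxy⟩ := exists_add_sq_eq hF ha hb (-c)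
  rcases eq_or_ne x 0 with rfl | hx
  · have hy : y ≠ 0 := by
      rintro rfl
      simp at hxy
      exact hc hxy
    obtain ⟨U, U', W, d, hd, h⟩ := exists_ternary_of_ne_zero hb ha hc
      ((add_comm _ _).trans hxy) hy Y X Z
    exact ⟨U, U', W, d, hd, fun p => by rw [← h]; ring⟩
  · exact exists_ternary_of_ne_zero ha hb hc hxy hx X Y Z

/-- Normal form of quadratic forms over a finite field of odd characteristic: products of
linear forms, and at most two squares. -/
theorem exists_isHypSum (hF : ringChar F ≠ 2) : ∀ {m : ℕ} {A : Matrix (Fin m) (Fin m) F},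
    A.IsSymm → ∃ (s : ℕ) (f : (Fin m → F) → F), IsHypSum s f ∧
      ((A.rank = 2 * s ∧ ∀ x, quadVal A x = f x) ∨
      (∃ (c : F) (X : Module.Dual F (Fin m → F)), c ≠ 0 ∧ A.rank = 2 * s + 1 ∧
        ∀ x, quadVal A x = f x + c * X x ^ 2) ∨
      (∃ (a b : F) (X Y : Module.Dual F (Fin m → F)), a ≠ 0 ∧ b ≠ 0 ∧ A.rank = 2 * s + 2 ∧
        ∀ x, quadVal A x = f x + (a * X x ^ 2 + b * Y x ^ 2))) := by
  classical
  have h2 : (2 : F) ≠ 0 := Ring.two_ne_zero hF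
  intro m
  induction m with
  | zero =>
    intro A _
    refine ⟨0, fun _ => 0, ⟨fun p => p.1.elim0, by simp⟩, Or.inl ⟨?_, fun x => ?_⟩⟩
    · exact Nat.le_zero.1 (A.rank_le_height)
    · simp [quadVal]
  | succ n ih =>
    intro A hA
    rw [eq_bord hA]
    have hB := hA.submatrix (Fin.succ (n := n))
    generalize A.submatrix Fin.succ Fin.succ = B at *
    generalize (fun j : Fin n => A 0 j.succ) = v
    generalize A 0 0 = a
    obtain ⟨s, f, hf, h⟩ := ih hB
    set Z : Module.Dual F (Fin (n + 1) → F) := LinearMap.proj 0 with hZ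
    by_cases hv : v ∈ Set.range B.mulVec
    · obtain ⟨w, rfl⟩ := hv
      set L : (Fin (n + 1) → F) →ₗ[F] (Fin n → F) :=
        LinearMap.funLeft F F Fin.succ + Z.smulRight w with hL
      have hQ : ∀ x, quadVal (bord a (B.mulVec w) B) x =
          quadVal B (L x) + (a - quadVal B w) * Z x ^ 2 := fun x => by
        conv_lhs => rw [← Fin.cons_self_tail x, quadVal_bord_mulVec hB, add_comm]
        rfl
      simp only [hQ]
      by_cases hc : a = quadVal B w
      · have hr := rank_bord_mulVec h2 hB a w
        rw [if_pos hc, add_zero] at hr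
        rw [hr, sub_eq_zero.2 hc]
        simp only [zero_mul, add_zero]
        refine ⟨s, _, hf.comp L, ?_⟩
        rcases h with ⟨h1, h⟩ | ⟨c, X, hc, h1, h⟩ | ⟨a, b, X, Y, ha, hb, h1, h⟩
        · exact Or.inl ⟨h1, fun x => h _⟩
        · exact Or.inr (Or.inl ⟨c, X ∘ₗ L, hc, h1, fun x => h _⟩)
        · exact Or.inr (Or.inr ⟨a, b, X ∘ₗ L, Y ∘ₗ L, ha, hb, h1, fun x => h _⟩)
      · have hr := rank_bord_mulVec h2 hB a w
        rw [if_neg hc] at hr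
        rw [hr]
        have hc' := sub_ne_zero.2 hc
        generalize a - quadVal B w = e at hc' ⊢
        rcases h with ⟨h1, h⟩ | ⟨c, X, hc, h1, h⟩ | ⟨a, b, X, Y, ha, hb, h1, h⟩
        · exact ⟨s, _, hf.comp L, Or.inr (Or.inl ⟨e, Z, hc', by omega, fun x => by rw [h]⟩)⟩
        · exact ⟨s, _, hf.comp L, Or.inr (Or.inr ⟨c, e, X ∘ₗ L, Z, hc, hc', by omega,
            fun x => by rw [h, LinearMap.comp_apply, add_assoc]⟩)⟩
        -- Three squares are traded for one product and one square.
        · obtain ⟨U, U', W, d, hd, hU⟩ := exists_ternary hF ha hb hc' (X ∘ₗ L) (Y ∘ₗ L) Z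
          refine ⟨s + 1, _, (hf.comp L).mul_add U U', Or.inr (Or.inl ⟨d, W, hd, by omega,
            fun x => ?_⟩)⟩
          have := hU x
          rw [LinearMap.comp_apply, LinearMap.comp_apply] at this
          rw [h]
          linear_combination this
    -- Outside the column space the terms involving the new coordinate already form a product of two
    -- linear forms, matching the rank increase of two.
    · set L : (Fin (n + 1) → F) →ₗ[F] (Fin n → F) := LinearMap.funLeft F F Fin.succ with hL
      set Z' : Module.Dual F (Fin (n + 1) → F) :=
        a • Z + (2 : F) • (dotProductBilin F F v ∘ₗ L) with hZ'
      have hQ : ∀ x, quadVal (bord a v B) x = Z x * Z' x + quadVal B (L x) := fun x => by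
        conv_lhs => rw [← Fin.cons_self_tail x, quadVal_bord]
        have h1 : Z x = x 0 := rfl
        have h3 : Z' x = a * x 0 + 2 * (v ⬝ᵥ Fin.tail x) := rfl
        have h4 : L x = Fin.tail x := rfl
        rw [h1, h3, h4]
        ring
      simp only [hQ]
      rw [rank_bord_of_notMem a hB hv]
      refine ⟨s + 1, _, (hf.comp L).mul_add Z Z', ?_⟩
      rcases h with ⟨h1, h⟩ | ⟨c, X, hc, h1, h⟩ | ⟨a, b, X, Y, ha, hb, h1, h⟩
      · exact Or.inl ⟨by omega, fun x => by rw [h]⟩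
      · exact Or.inr (Or.inl ⟨c, X ∘ₗ L, hc, by omega, fun x => by
          rw [h, LinearMap.comp_apply, add_assoc]⟩)
      · exact Or.inr (Or.inr ⟨a, b, X ∘ₗ L, Y ∘ₗ L, ha, hb, by omega, fun x => by
          rw [h, LinearMap.comp_apply, LinearMap.comp_apply, add_assoc]⟩)

/-- Every symmetric matrix of even rank is hyperbolic or elliptic. -/
theorem isHyperbolic_or_isElliptic (hF : ringChar F ≠ 2) {m t : ℕ}
    {A : Matrix (Fin m) (Fin m) F} (hA : A.IsSymm) (hr : A.rank = 2 * t) :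
    IsHyperbolic t A ∨ IsElliptic t A := by
  have h2 : (2 : F) ≠ 0 := Ring.two_ne_zero hF
  obtain ⟨s, f, hf, ⟨h1, h⟩ | ⟨c, X, hc, h1, h⟩ | ⟨a, b, X, Y, ha, hb, h1, h⟩⟩ :=
    exists_isHypSum hF hA
  · obtain rfl : s = t := by omega
    refine Or.inl (isHyperbolic_of_isHypSum h2 hA hr ?_)
    rwa [funext h]
  · omega
  · obtain rfl : t = s + 1 := by omega
    -- The remaining binary form is a product of two linear forms if -b / a is a square, and
    -- irreducible otherwise.
    by_cases hsq : IsSquare (-b / a)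
    · obtain ⟨e, he⟩ := hsq
      refine Or.inl (isHyperbolic_of_isHypSum h2 hA hr ?_)
      convert hf.mul_add (a • (X - e • Y)) (X + e • Y) using 2 with x
      rw [h]
      simp only [LinearMap.add_apply, LinearMap.sub_apply, LinearMap.smul_apply, smul_eq_mul]
      field_simp at he
      linear_combination (-Y x ^ 2) * he
    · right
      obtain ⟨U, hU⟩ := hf
      set P : MvPolynomial (Fin 2) F := MvPolynomial.C a * MvPolynomial.X 0 ^ 2 +
        MvPolynomial.C b * MvPolynomial.X 1 ^ 2 with hP
      set X' : Fin (s + 1) × Fin 2 → Module.Dual F (Fin m → F) := fun p =>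
        Fin.cons (α := fun _ => Fin 2 → Module.Dual F (Fin m → F)) ![X, Y]
          (fun i j => U (i, j)) p.1 p.2 with hX'
      have hQ : ∀ x, quadVal A x = MvPolynomial.eval (fun j => X' (0, j) x) P +
          ∑ i : Fin s, X' (i.succ, 0) x * X' (i.succ, 1) x := fun x => by
        rw [h, hU]
        simp [hX', hP, add_comm]
      refine ⟨s, 1, P, X', rfl, one_ne_zero, ?_, irreducible_of_not_isSquare ha hsq, ?_, ?_⟩
      · refine MvPolynomial.IsHomogeneous.add ?_ ?_ <;>
          exact MvPolynomial.IsHomogeneous.C_mul (MvPolynomial.isHomogeneous_X_pow _ _) _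
      · exact linearIndependent_of_quadVal_eq h2 hA (by simp [hr, mul_comm]) X'
          (fun u => MvPolynomial.eval (fun j => u (0, j)) P +
            ∑ i : Fin s, u (i.succ, 0) * u (i.succ, 1)) hQ
      · simpa using hQ

end Classification

/-! ### The sign of a form, read off its exponential sum -/

section TypeSign

variable {F : Type*} [Field F]

open Classical in
/-- `1` on hyperbolic and `-1` on elliptic matrices of rank `2 * t`, and `0` on all others. -/
noncomputable def typeSign (t : ℕ) {m : ℕ} (A : Matrix (Fin m) (Fin m) F) : ℤ :=
  (if A.rank = 2 * t ∧ IsHyperbolic t A then 1 else 0) -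
    (if A.rank = 2 * t ∧ IsElliptic t A then 1 else 0)

theorem typeSign_of_rank_ne {t m : ℕ} {A : Matrix (Fin m) (Fin m) F} (h : A.rank ≠ 2 * t) :
    typeSign t A = 0 := by
  simp [typeSign, h]

variable [Fintype F] {ψ : AddChar F ℂ} {m n t : ℕ}

theorem card_cast_ne_zero : (Fintype.card F : ℂ) ≠ 0 := by simp

/-- At least one type occurs by the classification; both cannot, since their exponential sums are
non-zero and opposite. -/
theorem typeSign_spec (hF : ringChar F ≠ 2) (hψ : ψ.IsPrimitive)
    {A : Matrix (Fin m) (Fin m) F} (hA : A.IsSymm) (hr : A.rank = 2 * t) :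
    typeSign t A ^ 2 = 1 ∧ quadSum ψ 1 A * (Fintype.card F : ℂ) ^ t =
      (Fintype.card F : ℂ) ^ m * typeSign t A := by
  classical
  have hne : ¬ (IsHyperbolic t A ∧ IsElliptic t A) := fun ⟨h, h'⟩ => by
    have := (quadSum_of_isHyperbolic hψ h).symm.trans (quadSum_of_isElliptic hF hψ h')
    rw [self_eq_neg] at this
    exact pow_ne_zero m card_cast_ne_zero this
  rcases isHyperbolic_or_isElliptic hF hA hr with h | h
  · have h' : ¬ IsElliptic t A := fun h' => hne ⟨h, h'⟩
    have : typeSign t A = 1 := by simp [typeSign, hr, h, h']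
    simp [this, quadSum_of_isHyperbolic hψ h]
  · have h' : ¬ IsHyperbolic t A := fun h' => hne ⟨h', h⟩
    have : typeSign t A = -1 := by simp [typeSign, hr, h, h']
    simp [this, quadSum_of_isElliptic hF hψ h]

theorem typeSign_eq_of_quadSum_eq (hF : ringChar F ≠ 2) (hψ : ψ.IsPrimitive)
    {A : Matrix (Fin m) (Fin m) F} {B : Matrix (Fin n) (Fin n) F} {s : ℕ}
    (hA : A.IsSymm) (hB : B.IsSymm) (hAr : A.rank = 2 * t) (hBr : B.rank = 2 * s)
    (h : quadSum ψ 1 A * (Fintype.card F : ℂ) ^ (t + n) =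
      quadSum ψ 1 B * (Fintype.card F : ℂ) ^ (s + m)) : typeSign t A = typeSign s B := by
  have h1 := (typeSign_spec hF hψ hA hAr).2
  have h3 := (typeSign_spec hF hψ hB hBr).2
  have : (Fintype.card F : ℂ) ^ (m + n) * typeSign t A =
      (Fintype.card F : ℂ) ^ (m + n) * typeSign s B := by
    rw [pow_add] at h ⊢
    rw [pow_add] at h
    linear_combination (-(Fintype.card F : ℂ) ^ n) * h1 + h + (Fintype.card F : ℂ) ^ m * h3
  exact_mod_cast mul_left_cancel₀ (pow_ne_zero _ card_cast_ne_zero) this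

theorem typeSign_comp (hF : ringChar F ≠ 2) {A A' : Matrix (Fin m) (Fin m) F}
    (hA : A.IsSymm) (hA' : A'.IsSymm) (L : (Fin m → F) ≃+ (Fin m → F))
    (h : ∀ x, quadVal A' x = quadVal A (L x)) : typeSign t A' = typeSign t A := by
  have hr := rank_eq_of_quadVal_comp (Ring.two_ne_zero hF) hA hA' L h
  by_cases ht : A.rank = 2 * t
  · exact typeSign_eq_of_quadSum_eq hF (AddChar.FiniteField.primitiveChar_to_Complex_isPrimitive F)
      hA' hA (hr.trans ht) ht (by rw [quadSum_comp L h])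
  · rw [typeSign_of_rank_ne ht, typeSign_of_rank_ne (hr ▸ ht)]

/-- Scaling by s multiplies the sum by η(s) to the power of the rank, which is 1 for even rank. -/
theorem quadSum_of_rank_even (hF : ringChar F ≠ 2) (hψ : ψ.IsPrimitive)
    {A : Matrix (Fin m) (Fin m) F} (hA : A.IsSymm) (hr : A.rank = 2 * t) {s : F} (hs : s ≠ 0) :
    quadSum ψ s A = quadSum ψ 1 A := by
  classical
  obtain ⟨σ, -, h⟩ := exists_quadSum_eq hF hψ hA
  refine mul_right_cancel₀ (pow_ne_zero A.rank (card_cast_ne_zero (F := F))) ?_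
  have hη : (quadraticChar F s : ℂ) ^ 2 = 1 := by exact_mod_cast quadraticChar_sq_one hs
  rw [h s hs, h 1 one_ne_zero, hr, pow_mul (quadraticChar F s : ℂ), hη]
  simp

end TypeSign

/-! ### Signed counts of borders with given corner and block -/

section BorderSum

variable {F : Type*} [Field F] [Fintype F] [DecidableEq F] {ψ : AddChar F ℂ} {n t : ℕ}

/-- The sum of all `ψ (s * a)` with `s ≠ 0`, for a primitive character `ψ`. -/
def ramanujan (a : F) : ℤ := (if a = 0 then (Fintype.card F : ℤ) else 0) - 1

theorem sum_ne_zero_eq_ramanujan (hψ : ψ.IsPrimitive) (a : F) :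
    ∑ s with s ≠ 0, ψ (s * a) = ramanujan a := by
  have := AddChar.sum_mulShift a hψ
  rw [← Finset.sum_filter_add_sum_filter_not Finset.univ (· ≠ 0)] at this
  simp only [not_not, Finset.filter_eq', Finset.mem_univ, if_true,
    Finset.sum_singleton, zero_mul, AddChar.map_zero_eq_one] at this
  rw [ramanujan]
  push_cast at this ⊢
  linear_combination this

/-- The signed number of matrices of rank `2 * t` with prescribed corner and prescribed remaining
block. -/
noncomputable def borderSum (t : ℕ) (a : F) (B : Matrix (Fin n) (Fin n) F) : ℤ :=
  ∑ v, typeSign t (bord a v B)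

theorem pow_mul_sum_range {R : Type*} [CommRing R] (B : Matrix (Fin n) (Fin n) F)
    (f : (Fin n → F) → R) [DecidablePred (· ∈ Set.range B.mulVec)] :
    (Fintype.card F : R) ^ n * ∑ v with v ∈ Set.range B.mulVec, f v =
      (Fintype.card F : R) ^ B.rank * ∑ w, f (B.mulVec w) := by
  classical
  have := sum_comp_linearMap B.mulVecLin f
  rw [Module.finrank_fin_fun] at this
  rw [Matrix.rank]
  convert this.symm using 4 with v
  · simp
  · simp

/-- Borders outside the column space have rank different from 2t and drop out; the rest are
parametrised by `w`. -/
theorem pow_mul_borderSum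
{B : Matrix (Fin n) (Fin n) F} (hB : B.IsSymm) (a : F) (h : B.rank + 2 ≠ 2 * t) :
    (Fintype.card F : ℤ) ^ n * borderSum t a B =
      (Fintype.card F : ℤ) ^ B.rank * ∑ w, typeSign t (bord a (B.mulVec w) B) := by
  classical
  rw [← pow_mul_sum_range B fun v => typeSign t (bord a v B), borderSum,
    Finset.sum_filter_of_ne]
  intro v _ hv
  contrapose! hv
  exact typeSign_of_rank_ne (by rwa [rank_bord_of_notMem a hB hv])

/-- Orthogonality of characters: frequency zero gives the main term, and all other frequencies share
the same exponential sum because the rank is even. -/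
theorem card_mul_card_quadVal_eq (hF : ringChar F ≠ 2) {B : Matrix (Fin n) (Fin n) F}
    (hB : B.IsSymm) (hr : B.rank = 2 * t) (a : F) :
    (Fintype.card F : ℤ) ^ (t + 1) * (Finset.univ.filter fun w => a = quadVal B w).card =
      (Fintype.card F : ℤ) ^ n * ((Fintype.card F : ℤ) ^ t + typeSign t B * ramanujan a) := by
  have hψ := AddChar.FiniteField.primitiveChar_to_Complex_isPrimitive F
  set ψ := AddChar.FiniteField.primitiveChar_to_Complex F
  have h1 : (Fintype.card F : ℂ) * (Finset.univ.filter fun w => a = quadVal B w).card =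
      ∑ s : F, ∑ w, ψ (s * (a - quadVal B w)) := by
    rw [Finset.sum_comm]
    simp only [AddChar.sum_mulShift _ hψ, sub_eq_zero]
    push_cast
    rw [← Finset.sum_filter, Finset.sum_const, nsmul_eq_mul, mul_comm]
  have h3 : ∀ s : F, s ≠ 0 → ∑ w, ψ (s * (a - quadVal B w)) = quadSum ψ 1 B * ψ (s * a) := by
    intro s hs
    rw [← quadSum_of_rank_even hF hψ hB hr (neg_ne_zero.2 hs), quadSum, Finset.sum_mul]
    refine Finset.sum_congr rfl fun w _ => ?_
    rw [← AddChar.map_add_eq_mul]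
    ring_nf
  rw [← Finset.sum_filter_add_sum_filter_not Finset.univ (· ≠ 0),
    Finset.sum_congr rfl fun s hs => h3 s (Finset.mem_filter.1 hs).2, ← Finset.mul_sum,
    sum_ne_zero_eq_ramanujan hψ] at h1
  simp only [not_not, Finset.filter_eq', Finset.mem_univ, if_true,
    Finset.sum_singleton, zero_mul, AddChar.map_zero_eq_one, Finset.sum_const, Finset.card_univ,
    Fintype.card_fun, Fintype.card_fin, nsmul_eq_mul, mul_one] at h1
  have h4 := (typeSign_spec hF hψ hB hr).2
  have : (Fintype.card F : ℂ) ^ (t + 1) * (Finset.univ.filter fun w => a = quadVal B w).card =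
      (Fintype.card F : ℂ) ^ n * ((Fintype.card F : ℂ) ^ t + typeSign t B * ramanujan a) := by
    push_cast at h1
    linear_combination (Fintype.card F : ℂ) ^ t * h1 + ramanujan a * h4
  exact_mod_cast this

/-- A border Bw keeps the rank exactly when Q_B(w) = a, and then it keeps the type; this reduces the
sum to a point count on Q_B = a. -/
theorem borderSum_of_rank_eq (hF : ringChar F ≠ 2) {B : Matrix (Fin n) (Fin n) F}
    (hB : B.IsSymm) (hr : B.rank = 2 * t) (a : F) :
    (Fintype.card F : ℤ) * borderSum t a B =
      (Fintype.card F : ℤ) ^ (2 * t) * typeSign t B +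
        (Fintype.card F : ℤ) ^ t * ramanujan a := by
  have hψ := AddChar.FiniteField.primitiveChar_to_Complex_isPrimitive F
  have h2 : (2 : F) ≠ 0 := Ring.two_ne_zero hF
  have h1 : ∀ w, typeSign t (bord a (B.mulVec w) B) =
      if a = quadVal B w then typeSign t B else 0 := fun w => by
    have hrk := rank_bord_mulVec h2 hB a w
    split_ifs at hrk ⊢ with hw
    · refine typeSign_eq_of_quadSum_eq hF hψ (bord_isSymm hB) hB (by omega) hr ?_
      rw [quadSum_bord_mulVec hB, hw, sub_self, mul_zero, sqSum_zero]
      ring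
    · exact typeSign_of_rank_ne (by omega)
  have h3 := pow_mul_borderSum hB a (t := t) (by omega)
  have h4 := card_mul_card_quadVal_eq hF hB hr a
  have h5 := (typeSign_spec hF hψ hB hr).1
  simp only [h1, ← Finset.sum_filter, Finset.sum_const, nsmul_eq_mul] at h3
  have hq : (Fintype.card F : ℤ) ≠ 0 := by simp
  refine mul_left_cancel₀ (pow_ne_zero (n + t) hq) ?_
  rw [hr] at h3
  linear_combination (Fintype.card F : ℤ) ^ (t + 1) * h3 +
    (Fintype.card F : ℤ) ^ (2 * t) * typeSign t B * h4 +
    (Fintype.card F : ℤ) ^ (2 * t + n) * ramanujan a * h5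

/-- The sign of the border Bw is proportional to η(a - Q_B(w)). Expanding this through its Gauss sum
brings in the exponential sums of -sB, which carry a factor η(-s) since the rank is odd. The product
η(s)η(-s) = η(-1) does not depend on s, so a Ramanujan sum remains. -/
theorem borderSum_of_rank_add_one_eq (hF : ringChar F ≠ 2) {B : Matrix (Fin n) (Fin n) F}
    (hB : B.IsSymm) (hr : B.rank + 1 = 2 * t) (a : F) :
    (Fintype.card F : ℤ) * borderSum t a B = (Fintype.card F : ℤ) ^ t * ramanujan a := by
  have hψ := AddChar.FiniteField.primitiveChar_to_Complex_isPrimitive F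
  set ψ := AddChar.FiniteField.primitiveChar_to_Complex F
  have h2 : (2 : F) ≠ 0 := Ring.two_ne_zero hF
  obtain ⟨u, hu⟩ : ∃ u, B.rank = 2 * u + 1 := ⟨t - 1, by omega⟩
  have hη : ∀ a : F, a ≠ 0 → (quadraticChar F a : ℂ) ^ 2 = 1 := fun a ha => by
    exact_mod_cast quadraticChar_sq_one ha
  obtain ⟨σ, hσ, hS⟩ := exists_quadSum_eq hF hψ hB
  have hodd : ∀ s : F, s ≠ 0 →
      (quadraticChar F s : ℂ) ^ B.rank = quadraticChar F s := fun s hs => by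
    rw [hu, pow_succ, pow_mul, hη s hs, one_pow, one_mul]
  have hγ : (quadGauss ψ ^ B.rank) ^ 2 =
      (quadraticChar F (-1) : ℂ) * (Fintype.card F : ℂ) ^ B.rank := by
    rw [← pow_mul, mul_comm, pow_mul, quadGauss_sq hF hψ, mul_pow, hodd _ (by simp)]
  have h1 : ∀ w, (Fintype.card F : ℂ) ^ (n + 1) * (typeSign t (bord a (B.mulVec w) B) : ℂ) =
      quadSum ψ 1 B * (Fintype.card F : ℂ) ^ t *
        (quadraticChar F (a - quadVal B w) * quadGauss ψ) := fun w => by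
    have hrk := rank_bord_mulVec h2 hB a w
    split_ifs at hrk with hw
    -- Here the rank stays odd, and both sides vanish because η(0) = 0.
    · rw [typeSign_of_rank_ne (by omega), hw]
      simp
    · rw [← (typeSign_spec hF hψ (bord_isSymm hB) (by omega)).2, quadSum_bord_mulVec hB, one_mul,
        sqSum_eq hF hψ (sub_ne_zero.2 hw)]
      ring
  have h3 : ∑ w, ((quadraticChar F (a - quadVal B w) : ℂ) * quadGauss ψ) =
      ∑ s : F with s ≠ 0, (quadraticChar F s : ℂ) * ψ (s * a) * quadSum ψ (-s) B := by
    simp only [← sum_mul_quadraticChar hF]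
    rw [Finset.sum_comm, Finset.sum_filter_of_ne]
    · refine Finset.sum_congr rfl fun s _ => ?_
      rw [quadSum, Finset.mul_sum]
      refine Finset.sum_congr rfl fun w _ => ?_
      rw [mul_assoc, ← AddChar.map_add_eq_mul]
      ring_nf
    · rintro s - h rfl
      simp at h
  have h4 : (∑ w, ((quadraticChar F (a - quadVal B w) : ℂ) * quadGauss ψ)) *
      (Fintype.card F : ℂ) ^ B.rank = (Fintype.card F : ℂ) ^ n * σ * quadraticChar F (-1) *
        quadGauss ψ ^ B.rank * ramanujan a := by
    rw [h3, ← sum_ne_zero_eq_ramanujan hψ, Finset.sum_mul, Finset.mul_sum]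
    refine Finset.sum_congr rfl fun s hs => ?_
    have hs : s ≠ 0 := (Finset.mem_filter.1 hs).2
    rw [mul_assoc, hS _ (neg_ne_zero.2 hs), hodd _ (neg_ne_zero.2 hs), neg_eq_neg_one_mul s,
      map_mul (quadraticChar F), Int.cast_mul]
    linear_combination ((Fintype.card F : ℂ) ^ n * σ * quadraticChar F (-1) *
        quadGauss ψ ^ B.rank * ψ (s * a)) * hη s hs
  have h5 := hS 1 one_ne_zero
  simp only [map_one, Int.cast_one, one_pow, mul_one] at h5
  have h6 : (Fintype.card F : ℂ) ^ (n + 1) * ∑ w, (typeSign t (bord a (B.mulVec w) B) : ℂ) =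
      quadSum ψ 1 B * (Fintype.card F : ℂ) ^ t *
        ∑ w, ((quadraticChar F (a - quadVal B w) : ℂ) * quadGauss ψ) := by
    rw [Finset.mul_sum, Finset.mul_sum]
    exact Finset.sum_congr rfl fun w _ => h1 w
  have h7 := pow_mul_borderSum hB a (t := t) (by omega)
  have h7' : (Fintype.card F : ℂ) ^ n * borderSum t a B =
      (Fintype.card F : ℂ) ^ B.rank * ∑ w, (typeSign t (bord a (B.mulVec w) B) : ℂ) := by
    exact_mod_cast h7
  have h8 := hη (-1) (by simp)
  have : (Fintype.card F : ℂ) * borderSum t a B =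
      (Fintype.card F : ℂ) ^ t * ramanujan a := by
    refine mul_left_cancel₀ (pow_ne_zero (2 * n + B.rank) (card_cast_ne_zero (F := F))) ?_
    generalize ∑ w, ((quadraticChar F (a - quadVal B w) : ℂ) * quadGauss ψ) = E at *
    generalize ∑ w, (typeSign t (bord a (B.mulVec w) B) : ℂ) = T at *
    generalize quadSum ψ 1 B = Q at *
    generalize quadGauss ψ ^ B.rank = g at *
    generalize (quadraticChar F (-1) : ℂ) = e at *
    generalize (Fintype.card F : ℂ) = q at *
    rw [pow_add, pow_mul'] at *
    -- The relations σ² = 1, g² = e q^r with r the rank of B, and e² = 1 remove the undetermined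
    -- sign and the Gauss sum.
    linear_combination q ^ n * q ^ B.rank * q * h7' + q ^ B.rank * q ^ B.rank * h6 +
      q ^ t * Q * q ^ B.rank * h4 + q ^ t * (q ^ n * σ * e * g * ramanujan a) * h5 +
      q ^ t * (q ^ n) ^ 2 * e * ramanujan a * g ^ 2 * hσ +
      q ^ t * (q ^ n) ^ 2 * e * ramanujan a * hγ +
      q ^ t * (q ^ n) ^ 2 * ramanujan a * q ^ B.rank * h8
  exact_mod_cast this

/-- Only the q^n - q^(2t) borders outside the column space reach the required rank, and each
preserves the sign of B. -/
theorem borderSum_of_rank_add_two_eq (hF : ringChar F ≠ 2) {B : Matrix (Fin n) (Fin n) F}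
    (hB : B.IsSymm) (hr : B.rank = 2 * t) (a : F) :
    borderSum (t + 1) a B =
      ((Fintype.card F : ℤ) ^ n - (Fintype.card F : ℤ) ^ (2 * t)) * typeSign t B := by
  have hψ := AddChar.FiniteField.primitiveChar_to_Complex_isPrimitive F
  have h2 : (2 : F) ≠ 0 := Ring.two_ne_zero hF
  have hψ1 : AddChar.FiniteField.primitiveChar_to_Complex F ≠ 1 := by
    simpa using hψ one_ne_zero
  classical
  have h1 : ∀ v, typeSign (t + 1) (bord a v B) =
      typeSign t B - if v ∈ Set.range B.mulVec then typeSign t B else 0 := fun v => by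
    split_ifs with hv
    · obtain ⟨w, rfl⟩ := hv
      have hrk := rank_bord_mulVec h2 hB a w
      rw [typeSign_of_rank_ne (by split_ifs at hrk <;> omega), sub_self]
    · rw [sub_zero]
      refine typeSign_eq_of_quadSum_eq hF hψ (bord_isSymm hB) hB
        (by rw [rank_bord_of_notMem a hB hv]; omega) hr ?_
      rw [quadSum_bord_of_notMem h2 hψ1 a one_ne_zero hB hv]
      ring
  have h3 := pow_mul_sum_range B fun _ => (1 : ℤ)
  simp only [Finset.sum_const, nsmul_eq_mul, mul_one, Finset.card_univ, Fintype.card_fun,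
    Fintype.card_fin] at h3
  push_cast at h3
  rw [mul_comm] at h3
  have h4 := mul_right_cancel₀ (pow_ne_zero n (by simp : (Fintype.card F : ℤ) ≠ 0)) h3
  rw [borderSum]
  simp only [h1, Finset.sum_sub_distrib, ← Finset.sum_filter, Finset.sum_const, nsmul_eq_mul,
    Finset.card_univ, Fintype.card_fun, Fintype.card_fin, h4, hr]
  push_cast
  ring

theorem borderSum_of_rank_other (hF : ringChar F ≠ 2) {B : Matrix (Fin n) (Fin n) F}
    (hB : B.IsSymm) (h0 : B.rank ≠ 2 * t) (h1 : B.rank + 1 ≠ 2 * t) (h2 : B.rank + 2 ≠ 2 * t)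
    (a : F) : borderSum t a B = 0 := by
  refine Finset.sum_eq_zero fun v _ => typeSign_of_rank_ne ?_
  by_cases hv : v ∈ Set.range B.mulVec
  · obtain ⟨w, rfl⟩ := hv
    have hrk := rank_bord_mulVec (Ring.two_ne_zero hF) hB a w
    split_ifs at hrk <;> omega
  · rwa [rank_bord_of_notMem a hB hv]

/-- A uniform formula for all ranks of B, isolating the dependence on the corner in the term with
`ramanujan a`. -/
theorem card_mul_borderSum (hF : ringChar F ≠ 2) {B : Matrix (Fin n) (Fin n) F}
    (hB : B.IsSymm) (a : F) :
    (Fintype.card F : ℤ) * borderSum (t + 1) a B =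
      (Fintype.card F : ℤ) ^ (2 * (t + 1)) * typeSign (t + 1) B +
      (Fintype.card F : ℤ) * ((Fintype.card F : ℤ) ^ n - (Fintype.card F : ℤ) ^ (2 * t)) *
        typeSign t B +
      (Fintype.card F : ℤ) ^ (t + 1) * ramanujan a *
        if B.rank = 2 * t + 1 ∨ B.rank = 2 * t + 2 then 1 else 0 := by
  by_cases h0 : B.rank = 2 * (t + 1)
  · rw [borderSum_of_rank_eq hF hB h0, typeSign_of_rank_ne (t := t) (by omega),
      if_pos (by omega)]
    ring
  rw [typeSign_of_rank_ne h0]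
  by_cases h1 : B.rank + 1 = 2 * (t + 1)
  · rw [borderSum_of_rank_add_one_eq hF hB h1, typeSign_of_rank_ne (t := t) (by omega),
      if_pos (by omega)]
    ring
  rw [if_neg (by omega)]
  by_cases h2 : B.rank = 2 * t
  · rw [borderSum_of_rank_add_two_eq hF hB h2]
    ring
  · rw [borderSum_of_rank_other hF hB h0 h1 (by omega), typeSign_of_rank_ne h2]
    ring

end BorderSum

/-! ### The signed count of all symmetric matrices -/

section TypeSum

variable {F : Type*} [Field F] [Fintype F] [DecidableEq F] {n t : ℕ}

theorem sum_isSymm_succ {R : Type*} [AddCommMonoid R]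
    (f : Matrix (Fin (n + 1)) (Fin (n + 1)) F → R) :
    ∑ A with A.IsSymm, f A =
      ∑ B : Matrix (Fin n) (Fin n) F with B.IsSymm, ∑ a, ∑ v, f (bord a v B) := by
  simp only [← Fintype.sum_prod_type' fun a v => f (bord a v _)]
  rw [← Finset.sum_product' _ _ fun B (p : F × (Fin n → F)) => f (bord p.1 p.2 B)]
  refine Finset.sum_nbij' (fun A => (A.submatrix Fin.succ Fin.succ, A 0 0, fun j => A 0 j.succ))
    (fun p => bord p.2.1 p.2.2 p.1) ?_ ?_ ?_ ?_ ?_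
  · intro A hA
    simpa using (Finset.mem_filter.1 hA).2.submatrix _
  · intro p hp
    have hp : p.1.IsSymm := by simpa using hp
    simpa using bord_isSymm hp
  · intro A hA
    exact (eq_bord (Finset.mem_filter.1 hA).2).symm
  · intro p _
    rfl
  · intro A hA
    exact congrArg f (eq_bord (Finset.mem_filter.1 hA).2)

/-- The number of hyperbolic minus the number of elliptic `n × n` matrices of rank `2 * t`. -/
noncomputable def typeSum (F : Type*) [Field F] [Fintype F] [DecidableEq F] (t n : ℕ) : ℤ :=
  ∑ A : Matrix (Fin n) (Fin n) F with A.IsSymm, typeSign t A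

theorem typeSum_zero_left (h2 : (2 : F) ≠ 0) (n : ℕ) : typeSum F 0 n = 1 := by
  have h0 : (0 : Matrix (Fin n) (Fin n) F).IsSymm := Matrix.isSymm_zero
  rw [typeSum, Finset.sum_eq_single 0]
  · have h : IsHyperbolic 0 (0 : Matrix (Fin n) (Fin n) F) :=
      isHyperbolic_of_isHypSum h2 h0 (by simp) ⟨fun p => p.1.elim0, by simp [quadVal]⟩
    have h' : ¬ IsElliptic 0 (0 : Matrix (Fin n) (Fin n) F) := by
      rintro ⟨s, c, f, X, hs, -⟩
      omega
    simp [typeSign, h, h']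
  · intro A _ hA
    refine typeSign_of_rank_ne fun h => hA ?_
    rw [Matrix.rank, mul_zero, Submodule.finrank_eq_zero, LinearMap.range_eq_bot] at h
    ext i j
    simpa using congrFun (LinearMap.congr_fun h (Pi.single j 1)) i
  · simp [h0]

theorem typeSum_succ_zero (t : ℕ) : typeSum F (t + 1) 0 = 0 :=
  Finset.sum_eq_zero fun A _ => typeSign_of_rank_ne (by
    have := A.rank_le_height
    omega)

theorem sum_ramanujan : ∑ a : F, ramanujan a = 0 := by
  simp [ramanujan, Finset.sum_sub_distrib]

/-- Summing over all corners removes the Ramanujan term; the other two terms acquire a factor q. -/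
theorem typeSum_succ_succ (hF : ringChar F ≠ 2) (t n : ℕ) :
    typeSum F (t + 1) (n + 1) = (Fintype.card F : ℤ) ^ (2 * (t + 1)) * typeSum F (t + 1) n +
      (Fintype.card F : ℤ) * ((Fintype.card F : ℤ) ^ n - (Fintype.card F : ℤ) ^ (2 * t)) *
        typeSum F t n := by
  refine mul_left_cancel₀ (by simp : (Fintype.card F : ℤ) ≠ 0) ?_
  rw [typeSum, sum_isSymm_succ, typeSum, typeSum]
  simp only [Finset.mul_sum, mul_add, ← Finset.sum_add_distrib]
  refine Finset.sum_congr rfl fun B hB => ?_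
  have h := fun a => card_mul_borderSum (t := t) hF (Finset.mem_filter.1 hB).2 a
  simp only [borderSum, Finset.mul_sum] at h
  simp only [h, Finset.sum_add_distrib, ← Finset.sum_mul, ← Finset.mul_sum, sum_ramanujan,
    Finset.sum_const, Finset.card_univ, nsmul_eq_mul]
  ring

/-- Completing the square: with non-zero corner, the border may be cleared. -/
theorem sum_borderSum_of_ne_zero (hF : ringChar F ≠ 2) {a : F} (ha : a ≠ 0) :
    ∑ B : Matrix (Fin n) (Fin n) F with B.IsSymm, borderSum t a B =
      (Fintype.card F : ℤ) ^ n *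
        ∑ B : Matrix (Fin n) (Fin n) F with B.IsSymm, typeSign t (bord a 0 B) := by
  simp only [borderSum]
  rw [Finset.sum_comm]
  have h : ∀ v : Fin n → F,
      ∑ B : Matrix (Fin n) (Fin n) F with B.IsSymm, typeSign t (bord a v B) =
      ∑ B : Matrix (Fin n) (Fin n) F with B.IsSymm, typeSign t (bord a 0 B) := fun v => by
    have hv : (a⁻¹ • Matrix.vecMulVec v v).IsSymm := by
      ext i j
      simp [Matrix.vecMulVec_apply, mul_comm]
    symm
    refine Finset.sum_nbij' (· + a⁻¹ • Matrix.vecMulVec v v)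
      (· - a⁻¹ • Matrix.vecMulVec v v) ?_ ?_ (by simp) (by simp) ?_
    · intro B hB
      simpa using (Finset.mem_filter.1 hB).2.add hv
    · intro B hB
      simpa using (Finset.mem_filter.1 hB).2.sub hv
    · intro B hB
      have hB := (Finset.mem_filter.1 hB).2
      refine (typeSign_comp hF (bord_isSymm hB) (bord_isSymm (hB.add hv))
        (coshear (a⁻¹ • v)) fun x => ?_).symm
      conv_lhs => rw [← Fin.cons_self_tail x, quadVal_bord_add_vecMulVec ha]
      simp [coshear]
  simp [h]

/-- The sign is proportional to the one-variable sum of a x², hence to η(a), and η sums to zero. -/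
theorem sum_typeSign_bord_zero (hF : ringChar F ≠ 2) {B : Matrix (Fin n) (Fin n) F}
    (hB : B.IsSymm) : ∑ a : F with a ≠ 0, typeSign t (bord a 0 B) = 0 := by
  have hψ := AddChar.FiniteField.primitiveChar_to_Complex_isPrimitive F
  set ψ := AddChar.FiniteField.primitiveChar_to_Complex F
  by_cases hr : B.rank + 1 = 2 * t
  · have h : ∀ a ∈ Finset.univ.filter (fun a : F => a ≠ 0),
        (Fintype.card F : ℂ) ^ (n + 1) * (typeSign t (bord a 0 B) : ℂ) =
        sqSum ψ a * (quadSum ψ 1 B * (Fintype.card F : ℂ) ^ t) := fun a ha => by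
      rw [← (typeSign_spec hF hψ (bord_isSymm hB) (by
        rw [rank_bord_zero, if_neg (Finset.mem_filter.1 ha).2, hr])).2, quadSum_bord_zero,
        one_mul, mul_assoc]
    have h' := Finset.sum_congr rfl h
    rw [← Finset.mul_sum, ← Finset.sum_mul, sum_sqSum_ne_zero hF hψ, zero_mul, mul_eq_zero] at h'
    exact_mod_cast h'.resolve_left (pow_ne_zero _ card_cast_ne_zero)
  · refine Finset.sum_eq_zero fun a ha => typeSign_of_rank_ne ?_
    rwa [rank_bord_zero, if_neg (Finset.mem_filter.1 ha).2]

theorem typeSum_succ_eq_sum_borderSum_zero (hF : ringChar F ≠ 2) (t n : ℕ) :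
    typeSum F t (n + 1) =
      ∑ B : Matrix (Fin n) (Fin n) F with B.IsSymm, borderSum t 0 B := by
  rw [typeSum, sum_isSymm_succ, Finset.sum_comm,
    ← Finset.sum_filter_add_sum_filter_not Finset.univ fun a : F => a ≠ 0]
  have h : ∑ a : F with a ≠ 0, ∑ B : Matrix (Fin n) (Fin n) F with B.IsSymm,
      ∑ v, typeSign t (bord a v B) = 0 := by
    have h' : ∀ a ∈ Finset.univ.filter (fun a : F => a ≠ 0), _ := fun a ha =>
      sum_borderSum_of_ne_zero (n := n) (t := t) hF (Finset.mem_filter.1 ha).2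
    simp only [borderSum] at h'
    rw [Finset.sum_congr rfl h', ← Finset.mul_sum,
      Finset.sum_comm, Finset.sum_eq_zero fun B hB =>
        sum_typeSign_bord_zero hF (Finset.mem_filter.1 hB).2, mul_zero]
  rw [h, zero_add]
  simp only [not_not, Finset.filter_eq', Finset.mem_univ, if_true, Finset.sum_singleton]
  rfl

theorem borderSum_le_borderSum_zero (hF : ringChar F ≠ 2) {B : Matrix (Fin n) (Fin n) F}
    (hB : B.IsSymm) (a : F) : borderSum (t + 1) a B ≤ borderSum (t + 1) 0 B := by
  have hq : 0 < (Fintype.card F : ℤ) := by exact_mod_cast Fintype.card_pos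
  refine le_of_mul_le_mul_left ?_ hq
  rw [card_mul_borderSum hF hB, card_mul_borderSum hF hB]
  have : ramanujan a ≤ ramanujan (0 : F) := by
    simp only [ramanujan, if_true]
    split_ifs <;> omega
  gcongr

end TypeSum

/-! ### Product formula for the signed count -/

section ClosedForm

/-- Pulling q out of every factor but the first relates the numerators for consecutive matrix sizes.
-/
theorem prod_mul_sub_pow_succ (q x : ℝ) (k : ℕ) :
    ∏ i ∈ Finset.range (k + 1), (q * x - q ^ i) =
      (q * x - 1) * (q ^ k * ∏ i ∈ Finset.range k, (x - q ^ i)) := by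
  rw [Finset.prod_range_succ', pow_zero, mul_comm]
  congr 1
  rw [← Finset.card_range k, ← Finset.prod_const, Finset.card_range, ← Finset.prod_mul_distrib]
  exact Finset.prod_congr rfl fun i _ => by ring

theorem prod_pow_sub_pow_succ (q : ℝ) (t : ℕ) :
    ∏ i ∈ Finset.range (t + 1), (q ^ (2 * (t + 1)) - q ^ (2 * i)) =
      (q ^ (2 * (t + 1)) - 1) *
        (q ^ (2 * t) * ∏ i ∈ Finset.range t, (q ^ (2 * t) - q ^ (2 * i))) := by
  rw [Finset.prod_range_succ', mul_zero, pow_zero, mul_comm]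
  congr 1
  have : q ^ (2 * t) = ∏ _i ∈ Finset.range t, q ^ 2 := by simp [pow_mul]
  nth_rw 1 [this]
  rw [← Finset.prod_mul_distrib]
  exact Finset.prod_congr rfl fun i _ => by ring

theorem prod_pow_sub_pow_ne_zero {q : ℝ} (hq : 1 < q) (t : ℕ) :
    ∏ i ∈ Finset.range t, (q ^ (2 * t) - q ^ (2 * i)) ≠ 0 := by
  refine Finset.prod_ne_zero_iff.2 fun i hi => (sub_pos.2 ?_).ne'
  exact pow_lt_pow_right₀ hq (by have := Finset.mem_range.1 hi; omega)

variable {F : Type*} [Field F] [Fintype F] [DecidableEq F]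

theorem typeSum_eq (hF : ringChar F ≠ 2) : ∀ n t : ℕ, (typeSum F t n : ℝ) =
    (∏ i ∈ Finset.range (2 * t), ((Fintype.card F : ℝ) ^ n - (Fintype.card F : ℝ) ^ i)) /
      ∏ i ∈ Finset.range t, ((Fintype.card F : ℝ) ^ (2 * t) - (Fintype.card F : ℝ) ^ (2 * i)) := by
  have hq : 1 < (Fintype.card F : ℝ) := by exact_mod_cast Fintype.one_lt_card
  intro n
  induction n with
  | zero =>
    rintro (_ | t)
    · simp [typeSum_zero_left (Ring.two_ne_zero hF)]
    · rw [typeSum_succ_zero, Finset.prod_eq_zero (i := 0) (by simp) (by simp)]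
      simp
  | succ n ih =>
    rintro (_ | t)
    · simp [typeSum_zero_left (Ring.two_ne_zero hF)]
    · rw [typeSum_succ_succ hF]
      push_cast
      rw [ih, ih]
      have hD := prod_pow_sub_pow_ne_zero hq t
      have hD' := prod_pow_sub_pow_ne_zero hq (t + 1)
      rw [prod_pow_sub_pow_succ] at hD' ⊢
      rw [show 2 * (t + 1) = 2 * t + 1 + 1 by ring, pow_succ' _ n, prod_mul_sub_pow_succ,
        Finset.prod_range_succ _ (2 * t + 1), Finset.prod_range_succ _ (2 * t)] at *
      have hq0 : (Fintype.card F : ℝ) ≠ 0 := by positivity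
      have h1 := (mul_ne_zero_iff.1 hD').1
      generalize ∏ i ∈ Finset.range t,
        ((Fintype.card F : ℝ) ^ (2 * t) - (Fintype.card F : ℝ) ^ (2 * i)) = D at *
      generalize ∏ i ∈ Finset.range (2 * t),
        ((Fintype.card F : ℝ) ^ n - (Fintype.card F : ℝ) ^ i) = P at *
      field_simp
      ring

end ClosedForm

/-! ### From the signed sums to the counts -/

section Counting

variable {F : Type*} [Field F] [Fintype F] [DecidableEq F] {k t n : ℕ} {δ : F}

theorem ncard_sub_ncard_eq_sum {m : ℕ} (P : Matrix (Fin m) (Fin m) F → Prop)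
    [DecidablePred P] :
    ({A | A ∈ hypSet k δ t m ∧ P A}.ncard : ℤ) - {A | A ∈ ellSet k δ t m ∧ P A}.ncard =
      ∑ A with A.IsSymm, if diagForm k δ A = 0 ∧ P A then typeSign t A else 0 := by
  classical
  have h1 : {A | A ∈ hypSet k δ t m ∧ P A} = (Finset.univ.filter fun A =>
      A.IsSymm ∧ (diagForm k δ A = 0 ∧ P A) ∧ A.rank = 2 * t ∧ IsHyperbolic t A :
      Finset (Matrix (Fin m) (Fin m) F)) := by
    ext A
    simp [hypSet, symRank]
    tauto
  have h2 : {A | A ∈ ellSet k δ t m ∧ P A} = (Finset.univ.filter fun A =>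
      A.IsSymm ∧ (diagForm k δ A = 0 ∧ P A) ∧ A.rank = 2 * t ∧ IsElliptic t A :
      Finset (Matrix (Fin m) (Fin m) F)) := by
    ext A
    simp [ellSet, symRank]
    tauto
  rw [h1, h2, Set.ncard_coe_finset, Set.ncard_coe_finset, Finset.card_filter, Finset.card_filter,
    Finset.sum_filter]
  push_cast
  rw [← Finset.sum_sub_distrib]
  refine Finset.sum_congr rfl fun A _ => ?_
  by_cases hA : A.IsSymm <;> by_cases hP : diagForm k δ A = 0 ∧ P A <;> simp [hA, hP, typeSign]

theorem exists_diagForm_bord (hδ : δ ≠ 0) (hk : 1 ≤ k) : ∃ u : F, u ≠ 0 ∧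
    ∀ (a : F) (v : Fin n → F) (B : Matrix (Fin n) (Fin n) F),
      diagForm k δ (bord a v B) = u * a + diagForm (k - 1) δ B := by
  refine ⟨if k = 1 then δ else 1, by split_ifs <;> simp [hδ], fun a v B => ?_⟩
  rw [diagForm, Fin.sum_univ_succ, diagForm]
  congr 1
  · simp only [Fin.val_zero, bord_zero_zero, zero_add]
    split_ifs <;> first | omega | simp
  · refine Finset.sum_congr rfl fun i _ => ?_
    simp only [Fin.val_succ, bord_succ_succ]
    split_ifs <;> first | omega | rfl

/-- The corner has a non-zero coefficient in the diagonal form, so the linear condition determines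
it from B. The predicate `P` serves both the total count and a single fibre. -/
theorem sum_diagForm_eq_zero (hδ : δ ≠ 0) (hk : 1 ≤ k) : ∃ u : F, u ≠ 0 ∧
    ∀ (t : ℕ) (P : Matrix (Fin n) (Fin n) F → Prop) [DecidablePred P],
    ∑ A : Matrix (Fin (n + 1)) (Fin (n + 1)) F with A.IsSymm,
      (if diagForm k δ A = 0 ∧ P (A.submatrix Fin.succ Fin.succ) then typeSign t A else 0) =
    ∑ B : Matrix (Fin n) (Fin n) F with B.IsSymm,
      if P B then borderSum t (u * diagForm (k - 1) δ B) B else 0 := by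
  obtain ⟨u, hu, h⟩ := exists_diagForm_bord (n := n) hδ hk
  refine ⟨-u⁻¹, neg_ne_zero.2 (inv_ne_zero hu), fun t P _ => ?_⟩
  rw [sum_isSymm_succ]
  refine Finset.sum_congr rfl fun B _ => ?_
  have h1 : ∀ a : F, u * a + diagForm (k - 1) δ B = 0 ↔ a = -u⁻¹ * diagForm (k - 1) δ B := by
    intro a
    constructor
    · intro ha
      field_simp
      linear_combination ha
    · rintro rfl
      field_simp
      ring
  simp only [h, submatrix_bord, h1]
  by_cases hP : P B
  · simp only [hP, and_true, if_true]
    rw [Finset.sum_eq_single (-u⁻¹ * diagForm (k - 1) δ B)]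
    · simp [borderSum]
    · intro a _ ha
      simp only [if_neg ha, Finset.sum_const_zero]
    · simp
  · simp [hP]

theorem hypFibre_sub_ellFibre (hF : ringChar F ≠ 2) (hδ : δ ≠ 0) (hk : 1 ≤ k)
    {B : Matrix (Fin n) (Fin n) F} (hB : B.IsSymm) (hr : B.rank = 2 * t + 1)
    (hf : diagForm (k - 1) δ B ≠ 0) :
    (hypFibre k δ (t + 1) (n + 1) B : ℤ) - ellFibre k δ (t + 1) (n + 1) B =
      -(Fintype.card F : ℤ) ^ t := by
  obtain ⟨u, hu, h⟩ := sum_diagForm_eq_zero (n := n) hδ hk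
  have h1 := ncard_sub_ncard_eq_sum (k := k) (δ := δ) (t := t + 1)
    fun A : Matrix (Fin (n + 1)) (Fin (n + 1)) F => A.submatrix Fin.succ Fin.succ = B
  have h2 := h1.trans (h (t + 1) fun B' => B' = B)
  rw [Finset.sum_ite_eq' _ B, if_pos (by simpa using hB)] at h2
  refine Eq.trans h2 ?_
  refine mul_left_cancel₀ (by simp : (Fintype.card F : ℤ) ≠ 0) ?_
  rw [borderSum_of_rank_add_one_eq hF hB (by omega), ramanujan, if_neg (mul_ne_zero hu hf)]
  ring

theorem hypCount_sub_ellCount_le (hF : ringChar F ≠ 2) (hδ : δ ≠ 0) (hk : 1 ≤ k) (t n : ℕ) :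
    (hypCount k δ (t + 1) (n + 1) : ℤ) - ellCount k δ (t + 1) (n + 1) ≤
      typeSum F (t + 1) (n + 1) := by
  obtain ⟨u, hu, h⟩ := sum_diagForm_eq_zero (n := n) hδ hk
  have h1 := (ncard_sub_ncard_eq_sum (k := k) (δ := δ) (t := t + 1)
    fun _ : Matrix (Fin (n + 1)) (Fin (n + 1)) F => True).trans (h (t + 1) fun _ => True)
  simp only [and_true, if_true, Set.ofPred_mem_eq] at h1
  rw [hypCount, ellCount, h1, typeSum_succ_eq_sum_borderSum_zero hF]
  exact Finset.sum_le_sum fun B hB =>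
    borderSum_le_borderSum_zero hF (Finset.mem_filter.1 hB).2 _

end Counting

theorem mainTheorem6 {F : Type*} [Field F] [Fintype F] (q : ℕ) (hq : Fintype.card F = q)
    (hodd : Odd q) (δ : F) (hδ : δ ≠ 0) (t m k : ℕ) (ht : 1 ≤ t) (htm : 2 * t ≤ m)
    (hk : 1 ≤ k) (hkm : k ≤ m) :
    (hypCount k δ t m : ℝ) - (ellCount k δ t m : ℝ) ≤
        (q : ℝ) * ((∏ i ∈ Finset.range (2 * t - 1), ((q : ℝ) ^ (m - 1) - (q : ℝ) ^ i)) /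
          ∏ i ∈ Finset.range (t - 1), ((q : ℝ) ^ (2 * t - 2) - (q : ℝ) ^ (2 * i)))
        + (q : ℝ) ^ (2 * t) *
          ((∏ i ∈ Finset.range (2 * t), ((q : ℝ) ^ (m - 1) - (q : ℝ) ^ i)) /
            ∏ i ∈ Finset.range t, ((q : ℝ) ^ (2 * t) - (q : ℝ) ^ (2 * i))) ∧
    ∀ B ∈ symRank F (2 * t - 1) (m - 1), diagForm (k - 1) δ B ≠ 0 →
      (hypFibre k δ t m B : ℤ) - (ellFibre k δ t m B : ℤ) = -(q : ℤ) ^ (t - 1) := by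
  classical
  subst hq
  have hF : ringChar F ≠ 2 := fun h => by
    have := FiniteField.even_card_of_char_two h
    have := Nat.odd_iff.1 hodd
    omega
  obtain ⟨t, rfl⟩ : ∃ u, t = u + 1 := ⟨t - 1, by omega⟩
  obtain ⟨n, rfl⟩ : ∃ n, m = n + 1 := ⟨m - 1, by omega⟩
  refine ⟨?_, fun B hB hf => ?_⟩
  · have h1 : (hypCount k δ (t + 1) (n + 1) : ℝ) - (ellCount k δ (t + 1) (n + 1) : ℝ) ≤
        (typeSum F (t + 1) (n + 1) : ℝ) := by
      exact_mod_cast hypCount_sub_ellCount_le hF hδ hk t n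
    refine h1.trans_eq ?_
    rw [typeSum_succ_succ hF]
    push_cast
    -- The factor q^n - q^(2t) of the recurrence becomes the last factor of the first numerator.
    rw [typeSum_eq hF, typeSum_eq hF, show 2 * (t + 1) - 1 = 2 * t + 1 by omega,
      show 2 * (t + 1) - 2 = 2 * t by omega,
      Finset.prod_range_succ _ (2 * t)]
    ring
  · exact hypFibre_sub_ellFibre hF hδ hk hB.1 (hB.2.trans (by omega)) hf
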